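/- Let $n,n_u,n_v\in\mathbb N$, $\alpha\in(0,1)$, $T>0$, let $P\subset\mathbb R^{n_u}$ and $Q\subset\mathbb R^{n_v}$ be compact, and let $g:[0,T]\times\mathbb R^n\times P\times Q\to\mathbb R^n$ satisfy: (g.1) $g$ is continuous; (g.2) for every $r\ge 0$ there is $\lambda_g>0$ with $\|g(t,x,u,v)-g(t,y,u,v)\|\le\lambda_g\|x-y\|$ for all $t\in[0,T]$, $\|x\|,\|y\|\le r$, $u\in P$, $v\in Q$; (g.3) there is $c_g>0$ with $\|g(t,x,u,v)\|\le(1+\|x\|)c_g$ for all $t\in[0,T]$, $x\in\mathbb R^n$, $u\in P$, $v\in Q$; (g.4) $\min_{u\in P}\max_{v\in Q}\langle s,g(t,x,u,v)\rangle=\max_{v\in Q}\min_{u\in P}\langle s,g(t,x,u,v)\rangle$ for all $t\in[0,T]$, $x,s\in\mathbb R^n$. Here $\langle\cdot,\cdot\rangle$ and $\|\cdot\|$ are the Euclidean scalar product and norm. Let $\mathcal U$ and $\mathcal V$ be the sets of all Lebesgue measurable functions $[0,T)\to P$ and $[0,T)\to Q$, respectively. For $x_0\in\mathbb R^n$, $u\in\mathcal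 U$, $v\in\mathcal V$, a motion $x(\cdot;x_0,u,v)$ is a function $x:[0,T]\to\mathbb R^n$ of the form $$x(t)=x_0+\frac1{\Gamma(\alpha)}\int_0^t\frac{\varphi(\tau)}{(t-\tau)^{1-\alpha}}\,d\tau,\qquad t\in[0,T],$$ with some $\varphi\in L^\infty([0,T],\mathbb R^n)$, such that $({}^CD^\alpha x)(t)=g(t,x(t),u(t),v(t))$ for almost every $t\in[0,T]$, where $$({}^CD^\alpha x)(t)=\frac1{\Gamma(1-\alpha)}\frac{d}{dt}\int_0^t\frac{x(\tau)-x(0)}{(t-\tau)^{\alpha}}\,d\tau$$ is the Caputo derivative. A motion of the system is $x=x(\cdot;x_0,u,v)$, and a motion of the guide is $y=x(\cdot;y_0,\widetilde u,\widetilde v)$, with $y_0\in\mathbb R^n$, $\widetilde u\in\mathcal U$, $\widetilde v\in\mathcal V$. Given a partition $\Delta$: $0=\tau_1<\tau_2<\dots<\tau_{k+1}=T$, $k\ge1$, with diameter $\operatorname{diam}(\Delta)=\max_{1\le j\le k}(\tau_{j+1}-\tau_j)$, the realizations $u$ and $\widetilde v$ are said to be formed by the mutual aiming procedure if for every $j=1,\dots,k$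 there are, with $s(\tau_j)=x(\tau_j)-y(\tau_j)$, $$u_j\in\operatorname*{argmin}_{u\in P}\max_{v\in Q}\langle s(\tau_j),g(\tau_j,x(\tau_j),u,v)\rangle,\qquad \widetilde v_j\in\operatorname*{argmax}_{\widetilde v\in Q}\min_{\widetilde u\in P}\langle s(\tau_j),g(\tau_j,x(\tau_j),\widetilde u,\widetilde v)\rangle$$ such that $u(t)=u_j$ and $\widetilde v(t)=\widetilde v_j$ for all $t\in[\tau_j,\tau_{j+1})$. **Theorem.** For any $R_0>0$ and $\varepsilon>0$ there exist $K>0$ and $\delta>0$ such that, for any $x_0,y_0\in\mathbb R^n$ with $\|x_0\|,\|y_0\|\le R_0$, any partition $\Delta$ of $[0,T]$ with $\operatorname{diam}(\Delta)\le\delta$, and any $v\in\mathcal V$, $\widetilde u\in\mathcal U$: if $u\in\mathcal U$ and $\widetilde v\in\mathcal V$ are formed by the mutual aiming procedure, then the corresponding motions $x=x(\cdot;x_0,u,v)$ of the system and $y=x(\cdot;y_0,\widetilde u,\widetilde v)$ of the guide satisfy $$\|x(\cdot)-y(\cdot)\|_\infty=\operatorname*{ess\,sup}_{t\in[0,T]}\|x(t)-y(t)\|\le\varepsilon+K\|x_0-y_0\|.$$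 -/

import Mathlib

open MeasureTheory Set
open scoped ENNReal

noncomputable section

namespace FractionalControl

/-- The `k`-dimensional Euclidean space. -/
abbrev E (k : ℕ) := EuclideanSpace ℝ (Fin k)

/-- Lebesgue measure on the segment `[0, T]`. -/
abbrev segMeasure (T : ℝ) : Measure ℝ := volume.restrict (Icc 0 T)

/-- The left-sided Riemann-Liouville fractional integral of order `α`:
`(I^α φ)(t) = 1 / Γ(α) ∫₀ᵗ φ(τ) / (t - τ)^(1 - α) dτ`. -/
def rlIntegral {k : ℕ} (α : ℝ) (φ : ℝ → E k) (t : ℝ) : E k :=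
  (1 / Real.Gamma α) • ∫ τ in (0 : ℝ)..t, (1 / (t - τ) ^ (1 - α)) • φ τ

/-- `x` belongs to `{x₀} + I^α (L^∞([0, T], ℝ^k))`. Only the values of `x` on `[0, T]` matter. -/
def MemAddRLIntegral {k : ℕ} (α T : ℝ) (x₀ : E k) (x : ℝ → E k) : Prop :=
  ∃ φ : ℝ → E k, MemLp φ ∞ (segMeasure T) ∧ ∀ t ∈ Icc 0 T, x t = x₀ + rlIntegral α φ t

/-- The left-sided Caputo fractional derivative of order `α` of `x` exists at `t` and equals `d`:
`1 / Γ(1 - α) d/dt ∫₀ᵗ (x(τ) - x(0)) / (t - τ)^α dτ = d`. -/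
def HasCaputoDerivAt {k : ℕ} (α : ℝ) (x : ℝ → E k) (d : E k) (t : ℝ) : Prop :=
  HasDerivAt
    (fun r : ℝ => (1 / Real.Gamma (1 - α)) •
      ∫ τ in (0 : ℝ)..r, (1 / (r - τ) ^ α) • (x τ - x 0)) d t

/-- `x` is a solution on `[0, T]` of the Cauchy problem `(ᶜD^α x)(t) = f(t, x(t))`, `x(0) = x₀`:
it belongs to `{x₀} + I^α (L^∞)` and satisfies the equation almost everywhere on `[0, T]`. -/
def IsCauchySolution {n : ℕ} (α T : ℝ) (f : ℝ → E n → E n) (x₀ : E n) (x : ℝ → E n) : Prop :=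
  MemAddRLIntegral α T x₀ x ∧
    ∀ᵐ t ∂(segMeasure T), HasCaputoDerivAt α x (f t (x t)) t

/-- Admissible realizations: Lebesgue measurable functions `[0, T) → A`.
(For functions with values in a Euclidean space, almost everywhere measurability in Mathlib's
sense is the same as measurability with respect to the Lebesgue measurable sets.) -/
def IsAdmissible {k : ℕ} (T : ℝ) (A : Set (E k)) (w : ℝ → E k) : Prop :=
  AEMeasurable w (volume.restrict (Ico 0 T)) ∧ ∀ t ∈ Ico 0 T, w t ∈ A

section System

variable {n nu nv : ℕ}

/-- `max_{v ∈ Q} ⟨s, g(t, x, u, v)⟩`, as a function of `u`. -/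
def maxOverQ (Q : Set (E nv)) (g : ℝ → E n → E nu → E nv → E n)
    (t : ℝ) (x s : E n) (u : E nu) : ℝ :=
  ⨆ v : Q, inner ℝ s (g t x u v)

/-- `min_{u ∈ P} ⟨s, g(t, x, u, v)⟩`, as a function of `v`. -/
def minOverP (P : Set (E nu)) (g : ℝ → E n → E nu → E nv → E n)
    (t : ℝ) (x s : E n) (v : E nv) : ℝ :=
  ⨅ u : P, inner ℝ s (g t x u v)

/-- The standing conditions on `P`, `Q` and `g : [0, T] × ℝⁿ × P × Q → ℝⁿ`; nothing is asked of
`g` outside this domain. Under the first three conditions all infima and suprema in the last one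
are attained when `P` and `Q` are non-empty. -/
structure IsConflictSystem (T : ℝ) (P : Set (E nu)) (Q : Set (E nv))
    (g : ℝ → E n → E nu → E nv → E n) : Prop where
  compact_P : IsCompact P
  compact_Q : IsCompact Q
  continuousOn :
    ContinuousOn (fun z : ℝ × E n × E nu × E nv => g z.1 z.2.1 z.2.2.1 z.2.2.2)
      (Icc 0 T ×ˢ (univ : Set (E n)) ×ˢ P ×ˢ Q)
  locally_lipschitz : ∀ r : ℝ, 0 ≤ r → ∃ L : ℝ, 0 < L ∧
    ∀ t ∈ Icc 0 T, ∀ x ∈ Metric.closedBall (0 : E n) r, ∀ y ∈ Metric.closedBall (0 : E n) r,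
      ∀ u ∈ P, ∀ v ∈ Q, ‖g t x u v - g t y u v‖ ≤ L * ‖x - y‖
  linear_growth : ∃ c : ℝ, 0 < c ∧
    ∀ t ∈ Icc 0 T, ∀ x : E n, ∀ u ∈ P, ∀ v ∈ Q, ‖g t x u v‖ ≤ (1 + ‖x‖) * c
  saddle_point : ∀ t ∈ Icc 0 T, ∀ x s : E n,
    ⨅ u : P, maxOverQ Q g t x s u = ⨆ v : Q, minOverP P g t x s v

/-- `x` is the motion of `(ᶜD^α x)(t) = g(t, x(t), u(t), v(t))`, `x(0) = x₀`,
that corresponds to the realizations `u` and `v`. -/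
def IsMotion (α T : ℝ) (g : ℝ → E n → E nu → E nv → E n) (x₀ : E n)
    (u : ℝ → E nu) (v : ℝ → E nv) (x : ℝ → E n) : Prop :=
  IsCauchySolution α T (fun t z => g t z (u t) (v t)) x₀ x

/-- A partition `0 = τ₀ < τ₁ < … < τ_k = T` of the segment `[0, T]`. -/
structure TimePartition (T : ℝ) where
  k : ℕ
  node : Fin (k + 1) → ℝ
  strictMono : StrictMono node
  node_zero : node 0 = 0
  node_last : node (Fin.last k) = T

/-- The diameter of a partition: the largest length of one of its intervals. -/
def TimePartition.diam {T : ℝ} (Δ : TimePartition T) : ℝ :=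
  ⨆ j : Fin Δ.k, (Δ.node j.succ - Δ.node j.castSucc)

/-- The set of minimizers of `F` on `A`. -/
def argMin {k : ℕ} (A : Set (E k)) (F : E k → ℝ) : Set (E k) := {a ∈ A | IsMinOn F A a}

/-- The set of maximizers of `F` on `A`. -/
def argMax {k : ℕ} (A : Set (E k)) (F : E k → ℝ) : Set (E k) := {a ∈ A | IsMaxOn F A a}

/-- The control `u` of the system and the control `v'` of the guide are formed by the mutual
aiming procedure on the partition `Δ` along `x` and `y`: on every interval `[τ_j, τ_{j+1})`
each of them is constant and equal to an extremal value at the position at time `τ_j`,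
in the direction `s(τ_j) = x(τ_j) - y(τ_j)`. -/
def IsMutualAiming {T : ℝ} (P : Set (E nu)) (Q : Set (E nv))
    (g : ℝ → E n → E nu → E nv → E n) (Δ : TimePartition T)
    (x y : ℝ → E n) (u : ℝ → E nu) (v' : ℝ → E nv) : Prop :=
  ∀ j : Fin Δ.k,
    let τ := Δ.node j.castSucc
    (∃ uj ∈ argMin P (maxOverQ Q g τ (x τ) (x τ - y τ)),
      ∀ t ∈ Ico τ (Δ.node j.succ), u t = uj) ∧
    (∃ vj ∈ argMax Q (minOverP P g τ (x τ) (x τ - y τ)),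
      ∀ t ∈ Ico τ (Δ.node j.succ), v' t = vj)

end System

end FractionalControl

end

/-! The proof is Krasovskii's extremal aiming with `‖s‖²`, `s = x - y`, as the Lyapunov function.
There is no chain rule for the Caputo derivative; what replaces it is the energy inequality
`IsBoundedDensity.norm_sq_le`, that is, `‖s‖² ≤ ‖s₀‖² + 2 I^α⟨ψ, s⟩` for the density `ψ` of `s`.

Its core, `norm_abelIntegral_sq_le`, is a positivity statement. After reversing time, the integral
on the right becomes a double integral over `p < q` of `(1 - p/q)^(-(1-α)) ⟨f p, f q⟩`, where `f p =
p^(α-1) ψ(t - p)`. The binomial series of this kernel has nonnegative coefficients, and each power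
of `p/q`, symmetrized to `(min/max)ⁿ`, is a positive semidefinite kernel. The term `n = 0` alone
gives `‖∫ f‖²`, the square of the Abel integral, and all other terms may be dropped.

To use this for motions, the Caputo equation is turned into an integral equation whose density is
almost everywhere the right-hand side (`IsCauchySolution.exists_isBoundedDensity`). Linear growth
and the fractional Grönwall inequality then bound the motions uniformly, so they are uniformly
Hölder of order `α`. On a fine partition positions and time can therefore be frozen at the last
node; there the saddle point condition removes the contribution of the controls, and
`IsConflictSystem.exists_inner_le` leaves `⟨ψ, s⟩ ≤ L‖s‖² + η`. A second application of Grönwall,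
now to `‖s‖²`, gives the estimate. -/

namespace FractionalControl

/-! ### Abel integrals of bounded functions -/

/-- An essentially bounded function has a representative that is bounded everywhere. -/
theorem exists_stronglyMeasurable_norm_le {G : Type*} [NormedAddCommGroup G]
    {μ : Measure ℝ} {φ : ℝ → G} {C : ℝ} (hC0 : 0 ≤ C)
    (hφ : AEStronglyMeasurable φ μ) (hC : ∀ᵐ τ ∂μ, ‖φ τ‖ ≤ C) :
    ∃ φ' : ℝ → G, StronglyMeasurable φ' ∧ (∀ τ, ‖φ' τ‖ ≤ C) ∧ φ =ᵐ[μ] φ' := by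
  refine ⟨{τ | ‖hφ.mk φ τ‖ ≤ C}.indicator (hφ.mk φ), hφ.stronglyMeasurable_mk.indicator
    (measurableSet_le hφ.stronglyMeasurable_mk.norm.measurable measurable_const), ?_, ?_⟩
  · intro τ
    by_cases h : τ ∈ {τ | ‖hφ.mk φ τ‖ ≤ C}
    · rw [indicator_of_mem h]; exact h
    · rw [indicator_of_notMem h]; simpa using hC0
  · filter_upwards [hφ.ae_eq_mk, hC] with τ h1 h2
    rw [indicator_of_mem, h1]
    simpa [← h1] using h2

variable {F : Type*} [NormedAddCommGroup F] [NormedSpace ℝ F]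

/-- The Abel integral `∫₀ᵗ (t - τ)^(α - 1) φ(τ) dτ`, that is, the Riemann-Liouville integral
without its normalizing factor. -/
noncomputable def abelIntegral (α : ℝ) (φ : ℝ → F) (t : ℝ) : F :=
  ∫ τ in (0 : ℝ)..t, (t - τ) ^ (α - 1) • φ τ

theorem intervalIntegrable_sub_rpow {α : ℝ} (hα : 0 < α) (a b t : ℝ) :
    IntervalIntegrable (fun τ => (t - τ) ^ (α - 1)) volume a b := by
  have h := (intervalIntegral.intervalIntegrable_rpow' (a := t - a) (b := t - b)
    (r := α - 1) (by linarith)).comp_sub_left t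
  simpa using h

theorem integral_sub_rpow {α : ℝ} (hα : 0 < α) (a b t : ℝ) :
    ∫ τ in a..b, (t - τ) ^ (α - 1) = ((t - a) ^ α - (t - b) ^ α) / α := by
  rw [intervalIntegral.integral_comp_sub_left (fun x => x ^ (α - 1)) t,
    integral_rpow (Or.inl (by linarith))]
  simp

theorem intervalIntegrable_sub_rpow_smul {α : ℝ} (hα : 0 < α) {φ : ℝ → F} {C : ℝ}
    (hφ : StronglyMeasurable φ) (hC : ∀ τ, ‖φ τ‖ ≤ C) (a b t : ℝ) :
    IntervalIntegrable (fun τ => (t - τ) ^ (α - 1) • φ τ) volume a b := by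
  have h := intervalIntegrable_sub_rpow hα a b t
  rw [intervalIntegrable_iff] at h ⊢
  exact h.smul_bdd C hφ.aestronglyMeasurable (Filter.Eventually.of_forall hC)

theorem norm_integral_sub_rpow_smul_le {α : ℝ} (hα : 0 < α) {φ : ℝ → F} {C : ℝ}
    (hC : ∀ τ, ‖φ τ‖ ≤ C) {a b t : ℝ} (hab : a ≤ b) (hbt : b ≤ t) :
    ‖∫ τ in a..b, (t - τ) ^ (α - 1) • φ τ‖ ≤ C * (((t - a) ^ α - (t - b) ^ α) / α) := by
  rw [← integral_sub_rpow hα, ← intervalIntegral.integral_const_mul]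
  refine intervalIntegral.norm_integral_le_of_norm_le hab (Filter.Eventually.of_forall ?_)
    ((intervalIntegrable_sub_rpow hα a b t).const_mul C)
  intro τ hτ
  have h0 : 0 ≤ (t - τ) ^ (α - 1) := Real.rpow_nonneg (by linarith [hτ.2]) _
  rw [norm_smul, Real.norm_of_nonneg h0, mul_comm]
  exact mul_le_mul_of_nonneg_right (hC τ) h0

/-- The Abel integral of a bounded function is Hölder continuous of order `α`. -/
theorem norm_abelIntegral_sub_le {α : ℝ} (hα₀ : 0 < α) (hα₁ : α < 1) {φ : ℝ → F} {C : ℝ}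
    (hφ : StronglyMeasurable φ) (hC : ∀ τ, ‖φ τ‖ ≤ C) {r t : ℝ} (hr : 0 ≤ r) (hrt : r ≤ t) :
    ‖abelIntegral α φ t - abelIntegral α φ r‖ ≤ 2 * C / α * (t - r) ^ α := by
  have hC0 : 0 ≤ C := (norm_nonneg _).trans (hC 0)
  have hI := intervalIntegrable_sub_rpow_smul hα₀ hφ hC
  -- The kernel decreases in the upper time, so the change of kernel on `[0, r]` and the new piece
  -- on `[r, t]` each contribute at most `C (t - r)^α / α`; hence the factor 2.
  have hsplit : abelIntegral α φ t - abelIntegral α φ r =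
      (∫ τ in (0 : ℝ)..r, ((t - τ) ^ (α - 1) - (r - τ) ^ (α - 1)) • φ τ) +
        ∫ τ in r..t, (t - τ) ^ (α - 1) • φ τ := by
    simp only [sub_smul]
    rw [intervalIntegral.integral_sub (hI 0 r t) (hI 0 r r)]
    unfold abelIntegral
    rw [← intervalIntegral.integral_add_adjacent_intervals (hI 0 r t) (hI r t t)]
    abel
  have h1 : ‖∫ τ in (0 : ℝ)..r, ((t - τ) ^ (α - 1) - (r - τ) ^ (α - 1)) • φ τ‖ ≤
      C * ((t - r) ^ α / α) := by
    have hle : ‖∫ τ in (0 : ℝ)..r, ((t - τ) ^ (α - 1) - (r - τ) ^ (α - 1)) • φ τ‖ ≤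
        ∫ τ in (0 : ℝ)..r, C * ((r - τ) ^ (α - 1) - (t - τ) ^ (α - 1)) := by
      refine intervalIntegral.norm_integral_le_of_norm_le hr ?_
        (((intervalIntegrable_sub_rpow hα₀ 0 r r).sub
          (intervalIntegrable_sub_rpow hα₀ 0 r t)).const_mul C)
      have hne : ∀ᵐ τ : ℝ, τ ≠ r := by simp [ae_iff, measure_singleton]
      filter_upwards [hne] with τ hne hτ
      have hlt : τ < r := lt_of_le_of_ne hτ.2 hne
      have h0 : (t - τ) ^ (α - 1) ≤ (r - τ) ^ (α - 1) :=
        Real.rpow_le_rpow_of_nonpos (by linarith) (by linarith) (by linarith)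
      rw [norm_smul, Real.norm_of_nonpos (by linarith), neg_sub, mul_comm]
      exact mul_le_mul_of_nonneg_right (hC τ) (by linarith)
    refine hle.trans ?_
    rw [intervalIntegral.integral_const_mul, intervalIntegral.integral_sub
      (intervalIntegrable_sub_rpow hα₀ 0 r r) (intervalIntegrable_sub_rpow hα₀ 0 r t),
      integral_sub_rpow hα₀, integral_sub_rpow hα₀]
    refine mul_le_mul_of_nonneg_left ?_ hC0
    rw [← sub_div]
    refine div_le_div_of_nonneg_right ?_ hα₀.le
    have : r ^ α ≤ t ^ α := Real.rpow_le_rpow hr hrt hα₀.le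
    simp only [sub_self, sub_zero, Real.zero_rpow hα₀.ne']
    linarith
  have h2 := norm_integral_sub_rpow_smul_le hα₀ hC hrt (le_refl t)
  simp only [sub_self, sub_zero, Real.zero_rpow hα₀.ne'] at h2
  rw [hsplit]
  refine (norm_add_le _ _).trans ((add_le_add h1 h2).trans (le_of_eq ?_))
  ring

theorem continuousOn_abelIntegral {α : ℝ} (hα₀ : 0 < α) (hα₁ : α < 1) {φ : ℝ → F} {C : ℝ}
    (hφ : StronglyMeasurable φ) (hC : ∀ τ, ‖φ τ‖ ≤ C) :
    ContinuousOn (abelIntegral α φ) (Ici 0) := by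
  have hC0 : 0 ≤ C := (norm_nonneg _).trans (hC 0)
  have key : ∀ r ∈ Ici (0 : ℝ), ∀ t ∈ Ici (0 : ℝ),
      ‖abelIntegral α φ t - abelIntegral α φ r‖ ≤ 2 * C / α * |t - r| ^ α := by
    intro r hr t ht
    rcases le_total r t with h | h
    · rw [abs_of_nonneg (by linarith)]
      exact norm_abelIntegral_sub_le hα₀ hα₁ hφ hC hr h
    · rw [abs_sub_comm, abs_of_nonneg (by linarith), norm_sub_rev]
      exact norm_abelIntegral_sub_le hα₀ hα₁ hφ hC ht h
  intro r hr
  rw [ContinuousWithinAt, tendsto_iff_norm_sub_tendsto_zero]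
  have hlim : Filter.Tendsto (fun t => 2 * C / α * |t - r| ^ α) (nhdsWithin r (Ici 0)) (nhds 0) := by
    have hc : Continuous fun t : ℝ => 2 * C / α * |t - r| ^ α := by
      refine continuous_const.mul ((by fun_prop : Continuous fun t : ℝ => |t - r|).rpow_const ?_)
      intro; right; exact hα₀.le
    have := (hc.tendsto r).mono_left (nhdsWithin_le_nhds (s := Ici (0 : ℝ)))
    simpa [Real.zero_rpow hα₀.ne'] using this
  refine squeeze_zero' (Filter.Eventually.of_forall fun _ => norm_nonneg _) ?_ hlim
  filter_upwards [self_mem_nhdsWithin] with t ht using key r hr t ht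

theorem abelIntegral_congr_ae {α T t : ℝ} (ht : t ∈ Icc 0 T) {φ φ' : ℝ → F}
    (h : φ =ᵐ[volume.restrict (Icc 0 T)] φ') : abelIntegral α φ t = abelIntegral α φ' t := by
  refine intervalIntegral.integral_congr_ae ?_
  rw [Filter.EventuallyEq, ae_restrict_iff' measurableSet_Icc] at h
  filter_upwards [h] with τ hτ hτt
  rw [uIoc_of_le ht.1] at hτt
  rw [hτ ⟨hτt.1.le, hτt.2.trans ht.2⟩]

/-! ### Positive semidefinite kernels on the half-line -/

section EnergyInequality

variable {F : Type*} [NormedAddCommGroup F] [InnerProductSpace ℝ F]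

/-- The Gram representation of `min` in `L²(0, ∞)`, the source of all positivity below. -/
theorem integral_indicator_Iic_mul_indicator_Iic {a b : ℝ} (ha : 0 ≤ a) (hb : 0 ≤ b) :
    ∫ z in Ioi (0 : ℝ), (Iic a).indicator (fun _ => (1 : ℝ)) z *
      (Iic b).indicator (fun _ => (1 : ℝ)) z = min a b := by
  have h : (fun z => (Iic a).indicator (fun _ => (1 : ℝ)) z *
      (Iic b).indicator (fun _ => (1 : ℝ)) z) = (Iic (min a b)).indicator (fun _ => (1 : ℝ)) := by
    funext z
    by_cases h1 : z ≤ a <;> by_cases h2 : z ≤ b <;> simp [h1, h2]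
  rw [h, integral_indicator measurableSet_Iic, Measure.restrict_restrict measurableSet_Iic,
    inter_comm, Ioi_inter_Iic]
  simp [ha, hb]

/-- Weights of the form `c p * c q` keep a kernel positive semidefinite; this choice turns the
kernel `min` at `p^(2n)`, `q^(2n)` into a function of the ratio. -/
theorem inv_pow_mul_inv_pow_mul_min_pow {p q : ℝ} (hp : 0 < p) (hq : 0 < q) (n : ℕ) :
    (p ^ n)⁻¹ * (q ^ n)⁻¹ * min (p ^ (2 * n)) (q ^ (2 * n)) = (min p q / max p q) ^ n := by
  wlog h : p ≤ q generalizing p q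
  · rw [min_comm p, max_comm p, ← this hq hp (le_of_not_ge h), min_comm]; ring
  rw [min_eq_left h, max_eq_right h, min_eq_left (pow_le_pow_left₀ hp.le h _)]
  have : p ^ n ≠ 0 := (pow_pos hp n).ne'
  have : q ^ n ≠ 0 := (pow_pos hq n).ne'
  rw [div_pow]
  field_simp
  ring

theorem integral_prod_inner [CompleteSpace F] {μ : Measure ℝ} [SFinite μ] {f : ℝ → F}
    (hf : Integrable f μ) :
    ∫ z, inner ℝ (f z.1) (f z.2) ∂(μ.prod μ) = ‖∫ p, f p ∂μ‖ ^ 2 := by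
  rw [← real_inner_self_eq_norm_sq]
  exact integral_prod_bilin (innerSL ℝ) hf hf

/-- The kernel `(min p q / max p q)ⁿ` is positive semidefinite on the positive half-line. -/
theorem integral_min_div_max_pow_mul_inner_nonneg [CompleteSpace F] {μ : Measure ℝ} [SFinite μ]
    (hμ : ∀ᵐ p ∂μ, 0 < p) {f : ℝ → F} (hf : Integrable f μ) (n : ℕ) :
    0 ≤ ∫ z, (min z.1 z.2 / max z.1 z.2) ^ n * inner ℝ (f z.1) (f z.2) ∂(μ.prod μ) := by
  set ν : Measure ℝ := volume.restrict (Ioi 0)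
  -- The feature map: integrating `h p z * h q z` over `z` gives the kernel, so the double integral
  -- becomes an integral over `z` of squared norms.
  set h : ℝ → ℝ → ℝ := fun p z => (p ^ n)⁻¹ * (Iic (p ^ (2 * n))).indicator (fun _ => (1 : ℝ)) z
    with hh
  have hh0 : ∀ p z, 0 < p → 0 ≤ h p z := fun p z hp =>
    mul_nonneg (by positivity) (indicator_nonneg (fun _ _ => zero_le_one) _)
  have hmeas : Measurable fun w : ℝ × ℝ => h w.1 w.2 := by
    have hs : MeasurableSet {w : ℝ × ℝ | w.2 ≤ w.1 ^ (2 * n)} :=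
      measurableSet_le measurable_snd (measurable_fst.pow_const _)
    refine ((measurable_fst.pow_const n).inv).mul ((measurable_const (a := (1:ℝ))).indicator hs)
  have hint : ∀ p q, 0 < p → 0 < q →
      ∫ z, h p z * h q z ∂ν = (min p q / max p q) ^ n := by
    intro p q hp hq
    rw [← inv_pow_mul_inv_pow_mul_min_pow hp hq n, ← integral_indicator_Iic_mul_indicator_Iic
      (a := p ^ (2 * n)) (b := q ^ (2 * n)) (by positivity) (by positivity),
      ← integral_const_mul]
    exact integral_congr_ae (Filter.Eventually.of_forall fun z => by simp only [hh]; ring)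
  have hpos : ∀ᵐ w ∂(μ.prod μ), 0 < w.1 ∧ 0 < w.2 :=
    (Measure.quasiMeasurePreserving_fst.ae hμ).and (Measure.quasiMeasurePreserving_snd.ae hμ)
  have hnn : Integrable (fun w : ℝ × ℝ => ‖f w.1‖ * ‖f w.2‖) (μ.prod μ) := hf.norm.mul_prod hf.norm
  have hinner : AEStronglyMeasurable (fun w : ℝ × ℝ => inner ℝ (f w.1) (f w.2)) (μ.prod μ) :=
    hf.aestronglyMeasurable.comp_fst.inner hf.aestronglyMeasurable.comp_snd
  have hle1 : ∀ p q : ℝ, 0 < p → 0 < q → (min p q / max p q) ^ n ≤ 1 := by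
    intro p q hp hq
    refine pow_le_one₀ (by positivity) ?_
    rw [div_le_one (by positivity)]
    exact min_le_max
  have hG : Integrable (fun w : (ℝ × ℝ) × ℝ =>
      h w.1.1 w.2 * h w.1.2 w.2 * inner ℝ (f w.1.1) (f w.1.2)) ((μ.prod μ).prod ν) := by
    have hm : AEStronglyMeasurable (fun w : (ℝ × ℝ) × ℝ =>
        h w.1.1 w.2 * h w.1.2 w.2 * inner ℝ (f w.1.1) (f w.1.2)) ((μ.prod μ).prod ν) := by
      refine AEStronglyMeasurable.mul (Measurable.aestronglyMeasurable ?_) hinner.comp_fst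
      exact (hmeas.comp (by fun_prop : Measurable fun w : (ℝ × ℝ) × ℝ => (w.1.1, w.2))).mul
        (hmeas.comp (by fun_prop : Measurable fun w : (ℝ × ℝ) × ℝ => (w.1.2, w.2)))
    rw [integrable_prod_iff hm]
    constructor
    · filter_upwards [hpos] with w hw
      -- A non-integrable function has integral 0 by convention, while this integral is positive.
      refine (not_imp_comm.1 integral_undef ?_ : Integrable (fun z => h w.1 z * h w.2 z) ν).mul_const _
      rw [hint _ _ hw.1 hw.2]
      exact (pow_pos (div_pos (lt_min hw.1 hw.2) (hw.1.trans_le (le_max_left _ _))) n).ne'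
    · refine hnn.mono' hm.norm.integral_prod_right' ?_
      filter_upwards [hpos] with w hw
      have : ∀ z, ‖h w.1 z * h w.2 z * inner ℝ (f w.1) (f w.2)‖ =
          h w.1 z * h w.2 z * ‖(inner ℝ (f w.1) (f w.2) : ℝ)‖ := fun z => by
        rw [norm_mul, Real.norm_of_nonneg (mul_nonneg (hh0 _ _ hw.1) (hh0 _ _ hw.2))]
      simp only [this]
      rw [integral_mul_const, hint _ _ hw.1 hw.2, norm_mul, norm_norm,
        Real.norm_of_nonneg (pow_nonneg (div_nonneg (le_min hw.1.le hw.2.le)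
          (hw.1.le.trans (le_max_left _ _))) _)]
      refine (mul_le_of_le_one_left (norm_nonneg _) (hle1 _ _ hw.1 hw.2)).trans ?_
      exact norm_inner_le_norm _ _
  have hswap : ∫ w, (min w.1 w.2 / max w.1 w.2) ^ n * inner ℝ (f w.1) (f w.2) ∂(μ.prod μ) =
      ∫ z, ∫ w, h w.1 z * h w.2 z * inner ℝ (f w.1) (f w.2) ∂(μ.prod μ) ∂ν := by
    rw [← integral_integral_swap hG]
    refine integral_congr_ae ?_
    filter_upwards [hpos] with w hw
    rw [integral_mul_const, hint _ _ hw.1 hw.2]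
  rw [hswap]
  refine integral_nonneg_of_ae ?_
  filter_upwards [ae_restrict_mem measurableSet_Ioi] with z hz
  rw [mem_Ioi] at hz
  have hzf : Integrable (fun p => h p z • f p) μ := by
    -- On the support `z ≤ p^(2n)` the weight `a = (p^n)⁻¹` satisfies `a² ≤ 1/z`, and `a ≤ 1 + a²`.
    refine hf.bdd_smul (1 + 1 / z) (hmeas.comp
      (by fun_prop : Measurable fun p : ℝ => (p, z))).aestronglyMeasurable ?_
    filter_upwards [hμ] with p hp
    rw [Real.norm_of_nonneg (hh0 _ _ hp)]
    by_cases hzp : z ≤ p ^ (2 * n)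
    · have h1 : (p ^ n)⁻¹ * (p ^ n)⁻¹ ≤ 1 / z := by
        rw [← mul_inv, ← pow_add, ← two_mul, one_div]
        exact inv_anti₀ hz hzp
      have h2 : h p z = (p ^ n)⁻¹ := by simp [hh, hzp]
      rw [h2]
      nlinarith [sq_nonneg ((p ^ n)⁻¹ - 1), inv_nonneg.2 (pow_pos hp n).le]
    · have h2 : h p z = 0 := by simp [hh, hzp]
      rw [h2]
      positivity
  have heq : ∀ w : ℝ × ℝ, h w.1 z * h w.2 z * inner ℝ (f w.1) (f w.2) =
      inner ℝ (h w.1 z • f w.1) (h w.2 z • f w.2) := fun w => by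
    rw [real_inner_smul_left, real_inner_smul_right, mul_assoc]
  simp only [heq]
  rw [integral_prod_inner hzf]
  exact sq_nonneg _

theorem ae_prod_fst_ne_snd (μ : Measure ℝ) [SFinite μ] [NullSingletonClass μ] :
    ∀ᵐ z ∂(μ.prod μ), z.1 ≠ z.2 := by
  have h : (μ.prod μ) (diagonal ℝ) = 0 := by
    rw [Measure.measure_prod_null measurableSet_diagonal]
    refine Filter.Eventually.of_forall fun p => ?_
    have : Prod.mk p ⁻¹' diagonal ℝ = {p} := by ext q; simp [eq_comm]
    simp [this]
  exact measure_mono_null (fun z hz => by simpa using hz) h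

theorem integrable_min_div_max_pow_mul_inner {μ : Measure ℝ} [SFinite μ]
    (hμ : ∀ᵐ p ∂μ, 0 < p) {f : ℝ → F} (hf : Integrable f μ) (n : ℕ) :
    Integrable (fun z : ℝ × ℝ => (min z.1 z.2 / max z.1 z.2) ^ n * inner ℝ (f z.1) (f z.2))
      (μ.prod μ) := by
  have hpos : ∀ᵐ w ∂(μ.prod μ), 0 < w.1 ∧ 0 < w.2 :=
    (Measure.quasiMeasurePreserving_fst.ae hμ).and (Measure.quasiMeasurePreserving_snd.ae hμ)
  have hnn : Integrable (fun w : ℝ × ℝ => ‖f w.1‖ * ‖f w.2‖) (μ.prod μ) := hf.norm.mul_prod hf.norm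
  refine hnn.mono' (AEStronglyMeasurable.mul (Measurable.aestronglyMeasurable (by fun_prop))
    (hf.aestronglyMeasurable.comp_fst.inner hf.aestronglyMeasurable.comp_snd)) ?_
  filter_upwards [hpos] with w hw
  have h0 : 0 ≤ min w.1 w.2 / max w.1 w.2 :=
    div_nonneg (le_min hw.1.le hw.2.le) (hw.1.le.trans (le_max_left _ _))
  rw [norm_mul, Real.norm_of_nonneg (pow_nonneg h0 _)]
  refine (mul_le_of_le_one_left (norm_nonneg _) (pow_le_one₀ h0 ?_)).trans (norm_inner_le_norm _ _)
  rw [div_le_one (hw.1.trans_le (le_max_left _ _))]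
  exact min_le_max

/-- The integrand is symmetric and the diagonal is null, so the two triangles carry equal integrals.
-/
theorem two_mul_integral_indicator_div_pow_mul_inner {μ : Measure ℝ} [SFinite μ] [NullSingletonClass μ]
    (hμ : ∀ᵐ p ∂μ, 0 < p) {f : ℝ → F} (hf : Integrable f μ) (n : ℕ) :
    2 * ∫ z, {z : ℝ × ℝ | z.1 < z.2}.indicator
        (fun z => (z.1 / z.2) ^ n * inner ℝ (f z.1) (f z.2)) z ∂(μ.prod μ) =
      ∫ z, (min z.1 z.2 / max z.1 z.2) ^ n * inner ℝ (f z.1) (f z.2) ∂(μ.prod μ) := by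
  set K : ℝ × ℝ → ℝ := fun z => (min z.1 z.2 / max z.1 z.2) ^ n * inner ℝ (f z.1) (f z.2) with hK
  set S : Set (ℝ × ℝ) := {z | z.1 < z.2}
  have hS : MeasurableSet S := measurableSet_lt measurable_fst measurable_snd
  have hKi : Integrable K (μ.prod μ) := integrable_min_div_max_pow_mul_inner hμ hf n
  have h1 : S.indicator (fun z => (z.1 / z.2) ^ n * inner ℝ (f z.1) (f z.2)) = S.indicator K := by
    refine indicator_congr fun z hz => ?_
    have hz : z.1 < z.2 := hz
    simp [hK, min_eq_left hz.le, max_eq_right hz.le]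
  have h2 : ∫ z, S.indicator K z ∂(μ.prod μ) = ∫ z, Sᶜ.indicator K z ∂(μ.prod μ) := by
    rw [← integral_prod_swap]
    refine integral_congr_ae ?_
    filter_upwards [ae_prod_fst_ne_snd μ] with z hz
    have hswap : K z.swap = K z := by
      simp only [hK, Prod.fst_swap, Prod.snd_swap, min_comm z.2, max_comm z.2,
        real_inner_comm (f z.1)]
    by_cases h : z.1 < z.2
    · rw [indicator_of_notMem (show z.swap ∉ S from not_lt.2 h.le),
        indicator_of_notMem (show z ∉ Sᶜ from fun h' => h' h)]
    · have h' : z.2 < z.1 := lt_of_le_of_ne (not_lt.1 h) hz.symm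
      rw [indicator_of_mem (show z.swap ∈ S from h'), indicator_of_mem (show z ∈ Sᶜ from h), hswap]
  rw [h1, two_mul]
  nth_rewrite 2 [h2]
  rw [integral_indicator hS, integral_indicator hS.compl, integral_add_compl hS hKi]

/-- The binomial coefficients here are rising factorials of `b` divided by `n!`, hence nonnegative
for `b > 0`. Only this sign and the constant term matter later. -/
theorem exists_hasSum_one_sub_rpow_neg {b : ℝ} (hb : 0 < b) :
    ∃ c : ℕ → ℝ, c 0 = 1 ∧ (∀ n, 0 ≤ c n) ∧
      ∀ x : ℝ, 0 ≤ x → x < 1 → HasSum (fun n => c n * x ^ n) ((1 - x) ^ (-b)) := by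
  refine ⟨fun n => Ring.choose (b + n - 1) n, by simp, fun n => ?_, fun x hx0 hx1 => ?_⟩
  · have h := Ring.factorial_nsmul_multichoose_eq_ascPochhammer b n
    rw [Polynomial.ascPochhammer_smeval_eq_eval, nsmul_eq_mul] at h
    have hpos : 0 < (ascPochhammer ℝ n).eval b := ascPochhammer_pos n b hb
    have hdef : Ring.choose (b + n - 1) n = Ring.multichoose (b + n - 1 - n + 1) n := rfl
    beta_reduce
    rw [hdef, show b + n - 1 - n + 1 = b by ring]
    exact (pos_of_mul_pos_right (h ▸ hpos) (Nat.cast_nonneg _)).le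
  · have h := (Real.one_div_one_sub_rpow_hasFPowerSeriesOnBall_zero b).hasSum (y := x) (by
      simp [enorm_eq_nnnorm, ← NNReal.coe_lt_coe, abs_of_nonneg hx0, hx1])
    rw [Real.rpow_neg (by linarith)]
    simpa [FormalMultilinearSeries.ofScalars, mul_comm] using h

/-- Expand the kernel in powers of `p/q`: every term has a nonnegative integral, and the constant
term gives the left-hand side exactly. -/
theorem norm_integral_sq_le_two_mul_integral [CompleteSpace F] {μ : Measure ℝ} [SFinite μ]
    [NullSingletonClass μ] (hμ : ∀ᵐ p ∂μ, 0 < p) {f : ℝ → F} (hf : Integrable f μ) {b : ℝ} (hb : 0 < b)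
    (hint : Integrable ({z : ℝ × ℝ | z.1 < z.2}.indicator
      (fun z => (1 - z.1 / z.2) ^ (-b) * (‖f z.1‖ * ‖f z.2‖))) (μ.prod μ)) :
    ‖∫ p, f p ∂μ‖ ^ 2 ≤ 2 * ∫ z, {z : ℝ × ℝ | z.1 < z.2}.indicator
      (fun z => (1 - z.1 / z.2) ^ (-b) * inner ℝ (f z.1) (f z.2)) z ∂(μ.prod μ) := by
  obtain ⟨c, hc0, hcn, hc⟩ := exists_hasSum_one_sub_rpow_neg hb
  set S : Set (ℝ × ℝ) := {z | z.1 < z.2}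
  have hS : MeasurableSet S := measurableSet_lt measurable_fst measurable_snd
  have hpos : ∀ᵐ w ∂(μ.prod μ), 0 < w.1 ∧ 0 < w.2 :=
    (Measure.quasiMeasurePreserving_fst.ae hμ).and (Measure.quasiMeasurePreserving_snd.ae hμ)
  set G : ℕ → ℝ × ℝ → ℝ := fun n =>
    S.indicator (fun z => (z.1 / z.2) ^ n * inner ℝ (f z.1) (f z.2)) with hG
  have hGi : ∀ n, Integrable (G n) (μ.prod μ) := fun n => by
    have : G n = S.indicator
        (fun z => (min z.1 z.2 / max z.1 z.2) ^ n * inner ℝ (f z.1) (f z.2)) := by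
      refine indicator_congr fun z hz => ?_
      have hz : z.1 < z.2 := hz
      simp [min_eq_left hz.le, max_eq_right hz.le]
    rw [this]
    exact (integrable_min_div_max_pow_mul_inner hμ hf n).indicator hS
  have hG0 : ∀ n, 0 ≤ ∫ z, G n z ∂(μ.prod μ) := fun n => by
    have h1 := two_mul_integral_indicator_div_pow_mul_inner hμ hf n
    have h2 := integral_min_div_max_pow_mul_inner_nonneg hμ hf n
    rw [← h1] at h2
    simpa using h2
  have hGzero : 2 * ∫ z, G 0 z ∂(μ.prod μ) = ‖∫ p, f p ∂μ‖ ^ 2 := by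
    rw [two_mul_integral_indicator_div_pow_mul_inner hμ hf 0, ← integral_prod_inner hf]
    simp
  have hlim : Filter.Tendsto (fun N => ∫ z, ∑ n ∈ Finset.range N, c n * G n z ∂(μ.prod μ))
      Filter.atTop (nhds (∫ z, S.indicator
        (fun z => (1 - z.1 / z.2) ^ (-b) * inner ℝ (f z.1) (f z.2)) z ∂(μ.prod μ))) := by
    -- As the coefficients are nonnegative, partial sums are dominated by the full kernel, whose
    -- integrability is `hint`.
    refine tendsto_integral_of_dominated_convergence _
      (fun N => (integrable_finsetSum _ fun n _ => (hGi n).const_mul (c n)).aestronglyMeasurable)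
      hint (fun N => ?_) ?_
    · filter_upwards [hpos] with z hz
      by_cases hzS : z ∈ S
      · have hzlt : z.1 < z.2 := hzS
        have hx0 : 0 ≤ z.1 / z.2 := div_nonneg hz.1.le hz.2.le
        have hs := hc _ hx0 ((div_lt_one hz.2).2 hzlt)
        simp only [hG, indicator_of_mem hzS]
        simp only [← mul_assoc, ← Finset.sum_mul]
        rw [norm_mul, mul_assoc]
        have hle := hs.summable.sum_le_tsum (Finset.range N)
          (fun n _ => mul_nonneg (hcn n) (pow_nonneg hx0 n))
        rw [hs.tsum_eq] at hle
        rw [Real.norm_of_nonneg (Finset.sum_nonneg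
          (fun n _ => mul_nonneg (hcn n) (pow_nonneg hx0 n)))]
        exact mul_le_mul hle (norm_inner_le_norm _ _) (norm_nonneg _)
          (Real.rpow_nonneg (sub_nonneg.2 ((div_lt_one hz.2).2 hzlt).le) _)
      · simp [hG, indicator_of_notMem hzS]
    · filter_upwards [hpos] with z hz
      by_cases hzS : z ∈ S
      · have hzlt : z.1 < z.2 := hzS
        have hx0 : 0 ≤ z.1 / z.2 := div_nonneg hz.1.le hz.2.le
        have hs := (hc _ hx0 ((div_lt_one hz.2).2 hzlt)).mul_right (inner ℝ (f z.1) (f z.2) : ℝ)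
        simp only [hG, indicator_of_mem hzS, ← mul_assoc]
        exact hs.tendsto_sum_nat
      · simp [hG, indicator_of_notMem hzS]
  refine ge_of_tendsto (hlim.const_mul 2) ?_
  -- `N ≥ 1` ensures that the partial sum contains the term `n = 0`.
  filter_upwards [Filter.eventually_ge_atTop 1] with N hN
  rw [integral_finsetSum _ fun n _ => (hGi n).const_mul (c n), ← hGzero]
  refine mul_le_mul_of_nonneg_left ?_ zero_le_two
  simp only [integral_const_mul]
  have := Finset.single_le_sum (f := fun n => c n * ∫ z, G n z ∂(μ.prod μ))
    (fun n _ => mul_nonneg (hcn n) (hG0 n)) (Finset.mem_range.2 (Nat.lt_of_lt_of_le Nat.one_pos hN))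
  simpa [hc0] using this

end EnergyInequality
-- Double integrals with the Abel kernel, and the quadratic inequality
theorem integrableOn_abs_sub_rpow {α : ℝ} (hα : 0 < α) {x t : ℝ} (hx : x ∈ Icc 0 t) :
    IntegrableOn (fun y => |x - y| ^ (α - 1)) (Ioc 0 t) ∧
      ∫ y in Ioc 0 t, |x - y| ^ (α - 1) = (x ^ α + (t - x) ^ α) / α := by
  have e1 : EqOn (fun y => (x - y) ^ (α - 1)) (fun y => |x - y| ^ (α - 1)) (uIcc 0 x) := by
    intro y hy
    rw [uIcc_of_le hx.1] at hy
    simp only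
    rw [abs_of_nonneg (by linarith [hy.2])]
  have e2 : EqOn (fun y => (y - x) ^ (α - 1)) (fun y => |x - y| ^ (α - 1)) (uIcc x t) := by
    intro y hy
    rw [uIcc_of_le hx.2] at hy
    simp only
    rw [abs_sub_comm, abs_of_nonneg (by linarith [hy.1])]
  have i1 : IntervalIntegrable (fun y => |x - y| ^ (α - 1)) volume 0 x :=
    (intervalIntegrable_sub_rpow hα 0 x x).congr (e1.mono uIoc_subset_uIcc)
  have i2 : IntervalIntegrable (fun y => |x - y| ^ (α - 1)) volume x t := by
    have h := (intervalIntegral.intervalIntegrable_rpow' (a := x - x) (b := t - x)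
      (r := α - 1) (by linarith)).comp_sub_right x
    simp only [sub_add_cancel] at h
    exact h.congr (e2.mono uIoc_subset_uIcc)
  have h0t : 0 ≤ t := hx.1.trans hx.2
  constructor
  · exact (intervalIntegrable_iff_integrableOn_Ioc_of_le h0t).1 (i1.trans i2)
  · rw [← intervalIntegral.integral_of_le h0t, ← intervalIntegral.integral_add_adjacent_intervals
      i1 i2, ← intervalIntegral.integral_congr e1, ← intervalIntegral.integral_congr e2,
      integral_sub_rpow hα, intervalIntegral.integral_comp_sub_right (fun y => y ^ (α - 1)) x,
      integral_rpow (Or.inl (by linarith))]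
    simp [Real.zero_rpow hα.ne', add_div]

/-- Integrating out the second variable costs at most `2 t^α / α`, uniformly in the first. This is
the common dominating function for both uses of Fubini below. -/
theorem integrable_mul_abs_sub_rpow {α t : ℝ} (hα : 0 < α) {k : ℝ → ℝ}
    (hk : IntegrableOn k (Ioc 0 t)) :
    Integrable (fun z : ℝ × ℝ => k z.1 * |z.1 - z.2| ^ (α - 1))
      ((volume.restrict (Ioc 0 t)).prod (volume.restrict (Ioc 0 t))) := by
  have hm : AEStronglyMeasurable (fun z : ℝ × ℝ => k z.1 * |z.1 - z.2| ^ (α - 1))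
      ((volume.restrict (Ioc 0 t)).prod (volume.restrict (Ioc 0 t))) :=
    hk.aestronglyMeasurable.comp_fst.mul (Measurable.aestronglyMeasurable (by fun_prop))
  rw [integrable_prod_iff hm]
  constructor
  · filter_upwards [ae_restrict_mem measurableSet_Ioc] with x hx
    exact (integrableOn_abs_sub_rpow hα ⟨hx.1.le, hx.2⟩).1.const_mul _
  · refine (hk.norm.mul_const (2 * t ^ α / α)).mono' hm.norm.integral_prod_right' ?_
    filter_upwards [ae_restrict_mem measurableSet_Ioc] with x hx
    have h1 : ∀ y, ‖k x * |x - y| ^ (α - 1)‖ = ‖k x‖ * |x - y| ^ (α - 1) := fun y => by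
      rw [norm_mul, Real.norm_of_nonneg (Real.rpow_nonneg (abs_nonneg _) _)]
    simp only [h1]
    have hx0 : 0 ≤ x ^ α := Real.rpow_nonneg hx.1.le _
    have hx1 : 0 ≤ (t - x) ^ α := Real.rpow_nonneg (by linarith [hx.2]) _
    rw [integral_const_mul, (integrableOn_abs_sub_rpow hα ⟨hx.1.le, hx.2⟩).2,
      Real.norm_of_nonneg (by positivity)]
    refine mul_le_mul_of_nonneg_left (div_le_div_of_nonneg_right ?_ hα.le) (norm_nonneg _)
    have h2 : x ^ α ≤ t ^ α := Real.rpow_le_rpow hx.1.le hx.2 hα.le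
    have h3 : (t - x) ^ α ≤ t ^ α :=
      Real.rpow_le_rpow (by linarith [hx.2]) (by linarith [hx.1]) hα.le
    linarith

theorem stronglyMeasurable_comp_sub_left {G : Type*} [TopologicalSpace G] {ψ : ℝ → G}
    (hψ : StronglyMeasurable ψ) (t : ℝ) : StronglyMeasurable fun p => ψ (t - p) :=
  hψ.comp_measurable (by fun_prop)

section

variable {F : Type*} [NormedAddCommGroup F] [NormedSpace ℝ F]

/-- Moves the variable endpoint into an indicator, so that Fubini can be applied on a fixed square.
-/
theorem abelIntegral_sub_eq {α : ℝ} (ψ : ℝ → F) {p t : ℝ} (hp : p ∈ Icc 0 t) :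
    abelIntegral α ψ (t - p) =
      ∫ q in Ioc 0 t, (Ioi p).indicator (fun q => (q - p) ^ (α - 1) • ψ (t - q)) q := by
  have h := intervalIntegral.integral_comp_sub_left
    (fun b => (t - p - b) ^ (α - 1) • ψ b) t (a := p) (b := t)
  rw [sub_self] at h
  rw [abelIntegral, ← h, intervalIntegral.integral_of_le hp.2, integral_indicator measurableSet_Ioi,
    Measure.restrict_restrict measurableSet_Ioi, inter_comm, Ioc_inter_Ioi, max_eq_right hp.1]
  refine setIntegral_congr_fun measurableSet_Ioc fun q _ => ?_
  congr 2
  ring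

theorem abelIntegral_eq_setIntegral {α : ℝ} (ψ : ℝ → F) {r t : ℝ} (hr : r ∈ Icc 0 t) :
    abelIntegral α ψ r =
      ∫ q in Ioc 0 t, (Iio r).indicator (fun q => (r - q) ^ (α - 1) • ψ q) q := by
  rw [abelIntegral, intervalIntegral.integral_of_le hr.1, integral_indicator measurableSet_Iio,
    Measure.restrict_restrict measurableSet_Iio, inter_comm, integral_Ioc_eq_integral_Ioo]
  congr 2
  ext q
  simp only [mem_Ioo, mem_inter_iff, mem_Ioc, mem_Iio]
  exact ⟨fun h => ⟨⟨h.1, (h.2.trans_le hr.2).le⟩, h.2⟩, fun h => ⟨h.1.1, h.2⟩⟩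

/-- The exponents add up to `-1`, so the scaled Beta integral does not depend on `a`; it equals
`B(α, 1 - α)`, where `Γ(1) = 1`. -/
theorem integral_rpow_mul_sub_rpow_neg {α : ℝ} (hα₀ : 0 < α) (hα₁ : α < 1) {a : ℝ} (ha : 0 < a) :
    ∫ x in (0 : ℝ)..a, x ^ (α - 1) * (a - x) ^ (-α) = Real.Gamma α * Real.Gamma (1 - α) := by
  have h1 := Complex.betaIntegral_scaled α (1 - α) ha
  have h2 := Complex.Gamma_mul_Gamma_eq_betaIntegral (s := α) (t := 1 - α)
    (by simpa using hα₀) (by simpa using hα₁)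
  have e : (α : ℂ) + (1 - α) = 1 := by ring
  rw [e, Complex.Gamma_one, one_mul] at h2
  rw [e, sub_self, Complex.cpow_zero, one_mul, ← h2] at h1
  have h3 : ∫ x in (0 : ℝ)..a, (x : ℂ) ^ ((α : ℂ) - 1) * ((a : ℂ) - x) ^ ((1 - α : ℂ) - 1) =
      ((∫ x in (0 : ℝ)..a, x ^ (α - 1) * (a - x) ^ (-α) : ℝ) : ℂ) := by
    rw [← intervalIntegral.integral_ofReal]
    refine intervalIntegral.integral_congr fun x hx => ?_
    rw [uIcc_of_le ha.le] at hx
    rw [Complex.ofReal_mul, Complex.ofReal_cpow hx.1, Complex.ofReal_cpow (by linarith [hx.2])]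
    push_cast
    congr 2
    ring
  rw [h3, show (1 : ℂ) - α = ((1 - α : ℝ) : ℂ) by push_cast; ring, Complex.Gamma_ofReal,
    Complex.Gamma_ofReal] at h1
  exact_mod_cast h1

end

variable {F : Type*} [NormedAddCommGroup F] [InnerProductSpace ℝ F] [CompleteSpace F]

/-- For a bounded `ψ`, the square of the Abel integral of `ψ` is dominated by the Abel integral
of `2⟨ψ, ·⟩` along it. -/
theorem norm_abelIntegral_sq_le {α : ℝ} (hα₀ : 0 < α) (hα₁ : α < 1) {ψ : ℝ → F} {C : ℝ}
    (hψ : StronglyMeasurable ψ) (hC : ∀ τ, ‖ψ τ‖ ≤ C) {t : ℝ} (ht : 0 ≤ t) :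
    ‖abelIntegral α ψ t‖ ^ 2 ≤
      2 * ∫ τ in (0 : ℝ)..t, (t - τ) ^ (α - 1) * inner ℝ (ψ τ) (abelIntegral α ψ τ) := by
  set μ : Measure ℝ := volume.restrict (Ioc 0 t)
  have hμ : ∀ᵐ p ∂μ, 0 < p := by
    filter_upwards [ae_restrict_mem measurableSet_Ioc] with p hp using hp.1
  have hμt : ∀ᵐ p ∂μ, p ∈ Ioc 0 t := ae_restrict_mem measurableSet_Ioc
  have hpos : ∀ᵐ w ∂(μ.prod μ), w.1 ∈ Ioc 0 t ∧ w.2 ∈ Ioc 0 t :=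
    (Measure.quasiMeasurePreserving_fst.ae hμt).and (Measure.quasiMeasurePreserving_snd.ae hμt)
  have hC0 : 0 ≤ C := (norm_nonneg _).trans (hC 0)
  have hk : Integrable (fun p => p ^ (α - 1)) μ :=
    (intervalIntegrable_iff_integrableOn_Ioc_of_le ht).1
      (intervalIntegral.intervalIntegrable_rpow' (by linarith))
  have hψt := stronglyMeasurable_comp_sub_left hψ t
  set f : ℝ → F := fun p => p ^ (α - 1) • ψ (t - p) with hf
  have hfi : Integrable f μ :=
    hk.smul_bdd C hψt.aestronglyMeasurable (Filter.Eventually.of_forall fun _ => hC _)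
  set S : Set (ℝ × ℝ) := {z | z.1 < z.2}
  have hS : MeasurableSet S := measurableSet_lt measurable_fst measurable_snd
  -- The factor `q^(α-1)` contained in `f q` completes the ratio kernel to the Abel kernel `(q -
  -- p)^(α-1)`.
  have hker : ∀ p q : ℝ, 0 < p → p < q →
      (1 - p / q) ^ (-(1 - α)) * q ^ (α - 1) = (q - p) ^ (α - 1) := fun p q hp hpq => by
    have hq : 0 < q := hp.trans hpq
    rw [neg_sub, ← Real.mul_rpow (sub_nonneg.2 ((div_lt_one hq).2 hpq).le) hq.le]
    congr 1
    field_simp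
  have hdom : Integrable (fun z : ℝ × ℝ => C * C * (z.1 ^ (α - 1) * |z.1 - z.2| ^ (α - 1)))
      (μ.prod μ) := (integrable_mul_abs_sub_rpow hα₀ hk).const_mul _
  have hbound : ∀ w : ℝ × ℝ, 0 < w.1 → w.1 < w.2 →
      (1 - w.1 / w.2) ^ (-(1 - α)) * (‖f w.1‖ * ‖f w.2‖) ≤
        C * C * (w.1 ^ (α - 1) * |w.1 - w.2| ^ (α - 1)) := fun w h1 h2 => by
    have h3 : 0 ≤ w.1 ^ (α - 1) := Real.rpow_nonneg h1.le _
    have h4 : 0 ≤ w.2 ^ (α - 1) := Real.rpow_nonneg (h1.trans h2).le _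
    rw [abs_sub_comm, abs_of_pos (sub_pos.2 h2), ← hker _ _ h1 h2, hf]
    simp only [norm_smul, Real.norm_of_nonneg h3, Real.norm_of_nonneg h4]
    have h5 : 0 ≤ (1 - w.1 / w.2) ^ (-(1 - α)) :=
      Real.rpow_nonneg (sub_nonneg.2 ((div_lt_one (h1.trans h2)).2 h2).le) _
    have h6 : ‖ψ (t - w.1)‖ * ‖ψ (t - w.2)‖ ≤ C * C :=
      mul_le_mul (hC _) (hC _) (norm_nonneg _) hC0
    calc _ = ‖ψ (t - w.1)‖ * ‖ψ (t - w.2)‖ *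
          (w.1 ^ (α - 1) * ((1 - w.1 / w.2) ^ (-(1 - α)) * w.2 ^ (α - 1))) := by ring
      _ ≤ _ := mul_le_mul_of_nonneg_right h6 (by positivity)
  have hfm : StronglyMeasurable f :=
    (by fun_prop : Measurable fun p : ℝ => p ^ (α - 1)).stronglyMeasurable.smul hψt
  have hf1 : StronglyMeasurable fun z : ℝ × ℝ => f z.1 := hfm.comp_measurable measurable_fst
  have hf2 : StronglyMeasurable fun z : ℝ × ℝ => f z.2 := hfm.comp_measurable measurable_snd
  have hkm : StronglyMeasurable fun z : ℝ × ℝ => (1 - z.1 / z.2) ^ (-(1 - α)) :=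
    (by fun_prop : Measurable fun z : ℝ × ℝ => (1 - z.1 / z.2) ^ (-(1 - α))).stronglyMeasurable
  have hint : Integrable (S.indicator
      (fun z => (1 - z.1 / z.2) ^ (-(1 - α)) * (‖f z.1‖ * ‖f z.2‖))) (μ.prod μ) := by
    refine hdom.mono' ((hkm.mul (hf1.norm.mul hf2.norm)).indicator hS).aestronglyMeasurable ?_
    filter_upwards [hpos] with w hw
    by_cases h : w ∈ S
    · have hlt : w.1 < w.2 := h
      rw [indicator_of_mem h, Real.norm_of_nonneg (mul_nonneg (Real.rpow_nonneg (sub_nonneg.2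
        ((div_lt_one hw.2.1).2 hlt).le) _) (by positivity))]
      exact hbound w hw.1.1 hlt
    · rw [indicator_of_notMem h, norm_zero]
      have : 0 ≤ w.1 ^ (α - 1) := Real.rpow_nonneg hw.1.1.le _
      positivity
  have hint' : Integrable (S.indicator
      (fun z => (1 - z.1 / z.2) ^ (-(1 - α)) * inner ℝ (f z.1) (f z.2))) (μ.prod μ) := by
    refine hint.mono ((hkm.mul (hf1.inner hf2)).indicator hS).aestronglyMeasurable
      (Filter.Eventually.of_forall fun w => ?_)
    by_cases h : w ∈ S
    · rw [indicator_of_mem h, indicator_of_mem h, norm_mul, norm_mul, norm_mul (‖f w.1‖), norm_norm,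
        norm_norm]
      exact mul_le_mul_of_nonneg_left (norm_inner_le_norm _ _) (norm_nonneg _)
    · simp [indicator_of_notMem h]
  have main := norm_integral_sq_le_two_mul_integral hμ hfi (sub_pos.2 hα₁) hint
  have e1 : ∫ p, f p ∂μ = abelIntegral α ψ t := by
    have h := intervalIntegral.integral_comp_sub_left
      (fun τ => (t - τ) ^ (α - 1) • ψ τ) t (a := 0) (b := t)
    simp only [sub_sub_cancel, sub_self, sub_zero] at h
    rw [abelIntegral, ← h, intervalIntegral.integral_of_le ht]
  have e2 : ∫ z, S.indicator
      (fun z => (1 - z.1 / z.2) ^ (-(1 - α)) * inner ℝ (f z.1) (f z.2)) z ∂(μ.prod μ) =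
      ∫ τ in (0 : ℝ)..t, (t - τ) ^ (α - 1) * inner ℝ (ψ τ) (abelIntegral α ψ τ) := by
    have h := intervalIntegral.integral_comp_sub_left
      (fun τ => (t - τ) ^ (α - 1) * inner ℝ (ψ τ) (abelIntegral α ψ τ)) t (a := 0) (b := t)
    simp only [sub_sub_cancel, sub_self, sub_zero] at h
    rw [integral_prod _ hint', ← h, intervalIntegral.integral_of_le ht]
    refine integral_congr_ae ?_
    filter_upwards [hμt] with p hp
    rw [abelIntegral_sub_eq ψ ⟨hp.1.le, hp.2⟩, ← real_inner_smul_left, ← integral_inner]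
    · refine integral_congr_ae (Filter.Eventually.of_forall fun q => ?_)
      by_cases h : p < q
      · have hm : (p, q) ∈ S := h
        simp only [indicator_of_mem hm, indicator_of_mem (mem_Ioi.2 h)]
        rw [← hker p q hp.1 h, mul_smul, real_inner_smul_right _ (q ^ (α - 1) • ψ (t - q))]
      · have hm : (p, q) ∉ S := h
        have hm' : q ∉ Ioi p := h
        simp [indicator_of_notMem hm, indicator_of_notMem hm']
    · have hi := (integrableOn_abs_sub_rpow hα₀ ⟨hp.1.le, hp.2⟩).1
      refine Integrable.mono' (hi.const_mul C) (StronglyMeasurable.aestronglyMeasurable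
        (StronglyMeasurable.indicator ((by fun_prop : Measurable fun q : ℝ =>
          (q - p) ^ (α - 1)).stronglyMeasurable.smul hψt) measurableSet_Ioi))
        (Filter.Eventually.of_forall fun q => ?_)
      have hn : 0 ≤ |p - q| ^ (α - 1) := Real.rpow_nonneg (abs_nonneg _) _
      by_cases h : q ∈ Ioi p
      · rw [indicator_of_mem h, norm_smul, abs_sub_comm, abs_of_pos (sub_pos.2 h),
          Real.norm_of_nonneg (Real.rpow_nonneg (sub_pos.2 h).le _), mul_comm]
        exact mul_le_mul_of_nonneg_right (hC _) (Real.rpow_nonneg (sub_pos.2 h).le _)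
      · rw [indicator_of_notMem h, norm_zero]
        positivity
  rwa [e1, e2] at main

/-! ### Inversion of the Abel integral, and densities of motions -/

section

variable {F : Type*} [NormedAddCommGroup F] [NormedSpace ℝ F] [CompleteSpace F]

theorem setIntegral_indicator_mul_rpow {α : ℝ} (hα₀ : 0 < α) (hα₁ : α < 1) {σ r : ℝ}
    (hσ : 0 ≤ σ) (hσr : σ < r) :
    ∫ τ in Ioc 0 r, (Ioi σ).indicator (fun τ => (r - τ) ^ (-α) * (τ - σ) ^ (α - 1)) τ =
      Real.Gamma α * Real.Gamma (1 - α) := by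
  rw [integral_indicator measurableSet_Ioi, Measure.restrict_restrict measurableSet_Ioi,
    inter_comm, Ioc_inter_Ioi, max_eq_right hσ, ← intervalIntegral.integral_of_le hσr.le,
    ← integral_rpow_mul_sub_rpow_neg hα₀ hα₁ (sub_pos.2 hσr), ← sub_self σ,
    ← intervalIntegral.integral_comp_sub_right
      (fun x => x ^ (α - 1) * (r - σ - x) ^ (-α)) σ]
  refine intervalIntegral.integral_congr fun τ _ => ?_
  rw [mul_comm]
  congr 2
  ring

/-- The Abel integrals of orders `1 - α` and `α` compose to a multiple of the integral. -/
theorem integral_rpow_neg_smul_abelIntegral {α : ℝ} (hα₀ : 0 < α) (hα₁ : α < 1) {φ : ℝ → F}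
    {C : ℝ} (hφ : StronglyMeasurable φ) (hC : ∀ τ, ‖φ τ‖ ≤ C) {r : ℝ} (hr : 0 ≤ r) :
    ∫ τ in (0 : ℝ)..r, (r - τ) ^ (-α) • abelIntegral α φ τ =
      (Real.Gamma α * Real.Gamma (1 - α)) • ∫ τ in (0 : ℝ)..r, φ τ := by
  set μ : Measure ℝ := volume.restrict (Ioc 0 r)
  have hμr : ∀ᵐ p ∂μ, p ∈ Ioc 0 r := ae_restrict_mem measurableSet_Ioc
  have hC0 : 0 ≤ C := (norm_nonneg _).trans (hC 0)
  have hpos : ∀ᵐ w ∂(μ.prod μ), w.1 ∈ Ioc 0 r ∧ w.2 ∈ Ioc 0 r :=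
    (Measure.quasiMeasurePreserving_fst.ae hμr).and (Measure.quasiMeasurePreserving_snd.ae hμr)
  set S : Set (ℝ × ℝ) := {z | z.2 < z.1}
  have hS : MeasurableSet S := measurableSet_lt measurable_snd measurable_fst
  have hk : Integrable (fun τ => (r - τ) ^ (-α)) μ := by
    have h := intervalIntegrable_sub_rpow (sub_pos.2 hα₁) 0 r r
    rw [show 1 - α - 1 = -α by ring] at h
    exact (intervalIntegrable_iff_integrableOn_Ioc_of_le hr).1 h
  set G : ℝ × ℝ → F := S.indicator
    (fun z => ((r - z.1) ^ (-α) * (z.1 - z.2) ^ (α - 1)) • φ z.2) with hG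
  have hGi : Integrable G (μ.prod μ) := by
    refine ((integrable_mul_abs_sub_rpow hα₀ hk).const_mul C).mono'
      (StronglyMeasurable.aestronglyMeasurable (StronglyMeasurable.indicator
        ((by fun_prop : Measurable fun z : ℝ × ℝ =>
          (r - z.1) ^ (-α) * (z.1 - z.2) ^ (α - 1)).stronglyMeasurable.smul
          (hφ.comp_measurable measurable_snd)) hS)) ?_
    filter_upwards [hpos] with w hw
    have h1 : 0 ≤ (r - w.1) ^ (-α) := Real.rpow_nonneg (by linarith [hw.1.2]) _
    by_cases h : w ∈ S
    · have hlt : 0 < w.1 - w.2 := sub_pos.2 h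
      have h2 : 0 ≤ (w.1 - w.2) ^ (α - 1) := Real.rpow_nonneg hlt.le _
      rw [hG, indicator_of_mem h, abs_of_pos hlt, norm_smul, Real.norm_of_nonneg (by positivity),
        mul_comm]
      exact mul_le_mul_of_nonneg_right (hC _) (by positivity)
    · rw [hG, indicator_of_notMem h, norm_zero]
      have : 0 ≤ |w.1 - w.2| ^ (α - 1) := Real.rpow_nonneg (abs_nonneg _) _
      positivity
  have e1 : ∫ τ in (0 : ℝ)..r, (r - τ) ^ (-α) • abelIntegral α φ τ =
      ∫ τ, ∫ σ, G (τ, σ) ∂μ ∂μ := by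
    rw [intervalIntegral.integral_of_le hr]
    refine integral_congr_ae ?_
    filter_upwards [hμr] with τ hτ
    rw [abelIntegral_eq_setIntegral φ ⟨hτ.1.le, hτ.2⟩, ← integral_smul]
    refine integral_congr_ae (Filter.Eventually.of_forall fun σ => ?_)
    by_cases h : σ < τ
    · have hm : (τ, σ) ∈ S := h
      simp only [hG, indicator_of_mem hm, indicator_of_mem (mem_Iio.2 h), mul_smul]
    · have hm : (τ, σ) ∉ S := h
      have hm' : σ ∉ Iio τ := h
      simp [hG, indicator_of_notMem hm, indicator_of_notMem hm']
  rw [e1, integral_integral_swap (f := fun τ σ => G (τ, σ)) hGi,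
    intervalIntegral.integral_of_le hr, ← integral_smul]
  refine integral_congr_ae ?_
  have hne : ∀ᵐ σ ∂μ, σ ≠ r := ae_restrict_of_ae (by simp [ae_iff, measure_singleton])
  filter_upwards [hμr, hne] with σ hσ hσne
  rw [← setIntegral_indicator_mul_rpow hα₀ hα₁ hσ.1.le (lt_of_le_of_ne hσ.2 hσne),
    ← integral_smul_const]
  refine integral_congr_ae (Filter.Eventually.of_forall fun τ => ?_)
  by_cases h : σ < τ
  · have hm : (τ, σ) ∈ S := h
    simp only [hG, indicator_of_mem hm, indicator_of_mem (mem_Ioi.2 h)]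
  · have hm : (τ, σ) ∉ S := h
    have hm' : τ ∉ Ioi σ := h
    simp [hG, indicator_of_notMem hm, indicator_of_notMem hm']

theorem rlIntegral_eq_abelIntegral {k : ℕ} (α : ℝ) (φ : ℝ → E k) {t : ℝ} (ht : 0 ≤ t) :
    rlIntegral α φ t = (1 / Real.Gamma α) • abelIntegral α φ t := by
  rw [rlIntegral, abelIntegral]
  congr 1
  refine intervalIntegral.integral_congr fun τ hτ => ?_
  rw [uIcc_of_le ht] at hτ
  beta_reduce
  rw [one_div, ← Real.rpow_neg (sub_nonneg.2 hτ.2), neg_sub]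

end

/-- `φ` is a bounded density of `x` on `[0, T]`: `x = x₀ + I^α φ` there. -/
structure IsBoundedDensity {k : ℕ} (α T : ℝ) (x₀ : E k) (x φ : ℝ → E k) (C : ℝ) : Prop where
  stronglyMeasurable : StronglyMeasurable φ
  norm_le : ∀ τ, ‖φ τ‖ ≤ C
  eq_add : ∀ t ∈ Icc 0 T, x t = x₀ + (1 / Real.Gamma α) • abelIntegral α φ t

/-- Composing the integrals of orders `1 - α` and `α` reduces the function under the Caputo
derivative to `∫ φ`, and Lebesgue differentiation applies. -/
theorem IsBoundedDensity.hasDerivAt_ae {k : ℕ} {α T C : ℝ} (hα₀ : 0 < α) (hα₁ : α < 1)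
    {x₀ : E k} {x φ : ℝ → E k} (h : IsBoundedDensity α T x₀ x φ C) :
    ∀ᵐ t ∂(segMeasure T), HasCaputoDerivAt α x (φ t) t := by
  by_cases hT : 0 ≤ T
  swap
  · simp [segMeasure, Icc_eq_empty hT]
  have hx0 : x 0 = x₀ := by
    rw [h.eq_add 0 ⟨le_rfl, hT⟩, abelIntegral, intervalIntegral.integral_same, smul_zero, add_zero]
  have hloc : LocallyIntegrable φ volume :=
    (memLp_top_of_bound h.stronglyMeasurable.aestronglyMeasurable C
      (Filter.Eventually.of_forall h.norm_le)).locallyIntegrable le_top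
  have hΓ : Real.Gamma α ≠ 0 := (Real.Gamma_pos_of_pos hα₀).ne'
  have hΓ' : Real.Gamma (1 - α) ≠ 0 := (Real.Gamma_pos_of_pos (sub_pos.2 hα₁)).ne'
  have hrep : ∀ r ∈ Icc 0 T, (1 / Real.Gamma (1 - α)) •
      ∫ τ in (0 : ℝ)..r, (1 / (r - τ) ^ α) • (x τ - x 0) = ∫ τ in (0 : ℝ)..r, φ τ := by
    intro r hr
    have e : ∫ τ in (0 : ℝ)..r, (1 / (r - τ) ^ α) • (x τ - x 0) =
        (1 / Real.Gamma α) • ∫ τ in (0 : ℝ)..r, (r - τ) ^ (-α) • abelIntegral α φ τ := by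
      rw [← intervalIntegral.integral_smul]
      refine intervalIntegral.integral_congr fun τ hτ => ?_
      rw [uIcc_of_le hr.1] at hτ
      beta_reduce
      rw [hx0, h.eq_add τ ⟨hτ.1, hτ.2.trans hr.2⟩, add_sub_cancel_left, one_div,
        ← Real.rpow_neg (sub_nonneg.2 hτ.2), smul_comm]
    rw [e, integral_rpow_neg_smul_abelIntegral hα₀ hα₁ h.stronglyMeasurable h.norm_le hr.1,
      smul_smul, smul_smul]
    rw [show 1 / Real.Gamma (1 - α) * (1 / Real.Gamma α) * (Real.Gamma α * Real.Gamma (1 - α)) = 1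
      by field_simp, one_smul]
  rw [ae_restrict_iff' measurableSet_Icc]
  -- `hrep` holds only on `[0, T]`, while a two-sided derivative needs a neighbourhood; the
  -- endpoints are discarded as null.
  have h0 : ∀ᵐ t : ℝ, t ≠ 0 := by simp [ae_iff, measure_singleton]
  have h1 : ∀ᵐ t : ℝ, t ≠ T := by simp [ae_iff, measure_singleton]
  filter_upwards [LocallyIntegrable.ae_hasDerivAt_integral hloc, h0, h1] with t ht ht0 htT htI
  refine (ht 0).congr_of_eventuallyEq ?_
  filter_upwards [Icc_mem_nhds (lt_of_le_of_ne htI.1 ht0.symm) (lt_of_le_of_ne htI.2 htT)] with r hr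
  exact hrep r hr

/-- A solution of a Cauchy problem is the fractional integral of the right-hand side. -/
theorem IsCauchySolution.exists_isBoundedDensity {n : ℕ} {α T : ℝ} (hα₀ : 0 < α) (hα₁ : α < 1)
    {f : ℝ → E n → E n} {x₀ : E n} {x : ℝ → E n} (h : IsCauchySolution α T f x₀ x) :
    ∃ (φ : ℝ → E n) (C : ℝ), IsBoundedDensity α T x₀ x φ C ∧
      ∀ᵐ t ∂(segMeasure T), φ t = f t (x t) := by
  obtain ⟨⟨φ, hφ, hx⟩, hD⟩ := h
  obtain ⟨φ', h1, h2, h3⟩ := exists_stronglyMeasurable_norm_le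
    (C := (eLpNorm φ ∞ (segMeasure T)).toReal)
    ENNReal.toReal_nonneg hφ.aestronglyMeasurable (by
      filter_upwards [ae_le_eLpNormEssSup (f := φ) (μ := segMeasure T)] with t ht
      rw [← eLpNorm_exponent_top] at ht
      rw [← toReal_enorm]
      exact ENNReal.toReal_mono hφ.eLpNorm_ne_top ht)
  have hd : IsBoundedDensity α T x₀ x φ' (eLpNorm φ ∞ (segMeasure T)).toReal :=
    ⟨h1, h2, fun t ht => by
      rw [hx t ht, rlIntegral_eq_abelIntegral α φ ht.1, abelIntegral_congr_ae ht h3]⟩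
  refine ⟨φ', _, hd, ?_⟩
  filter_upwards [hD, hd.hasDerivAt_ae hα₀ hα₁] with t ht ht'
  -- The same function has both values as derivative at `t`, so the density is the right-hand side.
  exact ht'.unique ht

theorem IsBoundedDensity.continuousOn {k : ℕ} {α T C : ℝ} (hα₀ : 0 < α) (hα₁ : α < 1)
    {x₀ : E k} {x φ : ℝ → E k} (h : IsBoundedDensity α T x₀ x φ C) : ContinuousOn x (Icc 0 T) := by
  have ha : ContinuousOn (abelIntegral α φ) (Icc 0 T) :=
    (continuousOn_abelIntegral hα₀ hα₁ h.stronglyMeasurable h.norm_le).mono fun _ ht => ht.1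
  have hc : ContinuousOn (fun t => x₀ + (1 / Real.Gamma α) • abelIntegral α φ t) (Icc 0 T) := by
    fun_prop
  exact hc.congr fun t ht => h.eq_add t ht

theorem IsBoundedDensity.norm_increment_le {k : ℕ} {α T C : ℝ} (hα₀ : 0 < α) (hα₁ : α < 1)
    {x₀ : E k} {x φ : ℝ → E k} (h : IsBoundedDensity α T x₀ x φ C) {r t : ℝ} (hr : 0 ≤ r)
    (hrt : r ≤ t) (htT : t ≤ T) :
    ‖x t - x r‖ ≤ 1 / Real.Gamma α * (2 * C / α) * (t - r) ^ α := by
  rw [h.eq_add t ⟨hr.trans hrt, htT⟩, h.eq_add r ⟨hr, hrt.trans htT⟩, add_sub_add_left_eq_sub,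
    ← smul_sub, norm_smul, Real.norm_of_nonneg (by
      have := Real.Gamma_pos_of_pos hα₀; positivity), mul_assoc]
  exact mul_le_mul_of_nonneg_left
    (norm_abelIntegral_sub_le hα₀ hα₁ h.stronglyMeasurable h.norm_le hr hrt)
    (by have := Real.Gamma_pos_of_pos hα₀; positivity)

/-- A density may be modified to obey any almost everywhere bound on `[0, T]`. -/
theorem IsBoundedDensity.exists_norm_le {k : ℕ} {α T C C' : ℝ} (hC' : 0 ≤ C')
    {x₀ : E k} {x φ : ℝ → E k} (h : IsBoundedDensity α T x₀ x φ C)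
    (hle : ∀ᵐ t ∂(segMeasure T), ‖φ t‖ ≤ C') :
    ∃ φ' : ℝ → E k, IsBoundedDensity α T x₀ x φ' C' ∧ φ =ᵐ[segMeasure T] φ' := by
  obtain ⟨φ', h1, h2, h3⟩ := exists_stronglyMeasurable_norm_le hC'
    h.stronglyMeasurable.aestronglyMeasurable hle
  exact ⟨φ', ⟨h1, h2, fun t ht => by rw [h.eq_add t ht, abelIntegral_congr_ae ht h3]⟩, h3⟩

/-! ### The fractional Grönwall inequality -/

theorem intervalIntegrable_sub_rpow_mul_of_continuousOn {α : ℝ} (hα : 0 < α) {w : ℝ → ℝ} {T t : ℝ}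
    (hw : ContinuousOn w (Icc 0 T)) (ht : t ∈ Icc 0 T) (s : ℝ) :
    IntervalIntegrable (fun τ => (s - τ) ^ (α - 1) * w τ) volume 0 t := by
  refine (intervalIntegrable_sub_rpow hα 0 t s).mul_continuousOn (hw.mono ?_)
  rw [uIcc_of_le ht.1]
  exact Icc_subset_Icc_right ht.2

/-- Fractional Grönwall inequality. -/
theorem exists_fractional_gronwall {α : ℝ} (hα : 0 < α) (T : ℝ) {B : ℝ} (hB : 0 < B) :
    ∃ K : ℝ, 0 < K ∧ ∀ (A : ℝ) (w : ℝ → ℝ), 0 ≤ A → ContinuousOn w (Icc 0 T) →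
      (∀ t ∈ Icc 0 T, 0 ≤ w t) →
      (∀ t ∈ Icc 0 T, w t ≤ A + B * ∫ τ in (0 : ℝ)..t, (t - τ) ^ (α - 1) * w τ) →
      ∀ t ∈ Icc 0 T, w t ≤ K * A := by
  have hΓ := Real.Gamma_pos_of_pos hα
  -- With the weight `exp(-l τ)`, `l = 1/ρ`, the kernel has mass at most `ρ^α Γ(α)`. This `ρ` makes
  -- `B` times that mass equal to `1/2`, so the integral term can be absorbed.
  set ρ : ℝ := (1 / (2 * B * Real.Gamma α)) ^ (1 / α) with hρdef
  have hρ : 0 < ρ := Real.rpow_pos_of_pos (by positivity) _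
  have hρα : B * (ρ ^ α * Real.Gamma α) = 1 / 2 := by
    rw [hρdef, ← Real.rpow_mul (by positivity), one_div_mul_cancel hα.ne', Real.rpow_one]
    field_simp
  set l : ℝ := 1 / ρ with hl
  have hl0 : 0 < l := by positivity
  have hlaplace : ∀ t : ℝ, 0 ≤ t →
      ∫ τ in (0 : ℝ)..t, (t - τ) ^ (α - 1) * Real.exp (-(l * (t - τ))) ≤ ρ ^ α * Real.Gamma α := by
    intro t ht
    have h1 := Real.integral_rpow_mul_exp_neg_mul_Ioi hα hl0
    have h2 := intervalIntegral.integral_comp_sub_left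
      (fun r => r ^ (α - 1) * Real.exp (-(l * r))) t (a := 0) (b := t)
    rw [h2, sub_self, sub_zero, intervalIntegral.integral_of_le ht]
    rw [show 1 / l = ρ by rw [hl]; field_simp] at h1
    rw [← h1]
    refine setIntegral_mono_set ?_ ?_ (Filter.Eventually.of_forall Ioc_subset_Ioi_self)
    · refine not_imp_comm.1 integral_undef ?_
      rw [h1]
      have := Real.rpow_pos_of_pos hρ α
      positivity
    · filter_upwards [ae_restrict_mem measurableSet_Ioi] with r hr
      exact mul_nonneg (Real.rpow_nonneg (le_of_lt hr) _) (Real.exp_nonneg _)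
  refine ⟨2 * Real.exp (l * T), by positivity, fun A w hA hw hw0 hle t ht => ?_⟩
  have hT : 0 ≤ T := ht.1.trans ht.2
  have hc : ContinuousOn (fun τ => Real.exp (-(l * τ)) * w τ) (Icc 0 T) :=
    (by fun_prop : Continuous fun τ : ℝ => Real.exp (-(l * τ))).continuousOn.mul hw
  -- The hypothesis is used only at the maximum point `r` of the weighted function, where it reads
  -- `w r ≤ A + w r / 2`.
  obtain ⟨r, hr, hmax⟩ := isCompact_Icc.exists_isMaxOn ⟨t, ht⟩ hc
  set M : ℝ := Real.exp (-(l * r)) * w r with hM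
  have hM0 : 0 ≤ M := mul_nonneg (Real.exp_nonneg _) (hw0 r hr)
  have hwM : ∀ τ ∈ Icc 0 T, w τ ≤ M * Real.exp (l * τ) := fun τ hτ => by
    have h : Real.exp (-(l * τ)) * w τ ≤ M := hmax hτ
    rw [Real.exp_neg, inv_mul_le_iff₀ (Real.exp_pos _)] at h
    linarith
  have hint : ∫ τ in (0 : ℝ)..r, (r - τ) ^ (α - 1) * w τ ≤
      M * Real.exp (l * r) * (ρ ^ α * Real.Gamma α) := by
    refine le_trans ?_ (mul_le_mul_of_nonneg_left (hlaplace r hr.1) (by positivity))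
    rw [← intervalIntegral.integral_const_mul]
    refine intervalIntegral.integral_mono_on hr.1
      (intervalIntegrable_sub_rpow_mul_of_continuousOn hα hw hr r)
      (IntervalIntegrable.const_mul (intervalIntegrable_sub_rpow_mul_of_continuousOn hα
        (T := T) (by fun_prop) hr r) _) fun τ hτ => ?_
    have h0 : 0 ≤ (r - τ) ^ (α - 1) := Real.rpow_nonneg (by linarith [hτ.2]) _
    have h1 := hwM τ ⟨hτ.1, hτ.2.trans hr.2⟩
    have h2 : Real.exp (l * r) * Real.exp (-(l * (r - τ))) = Real.exp (l * τ) := by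
      rw [← Real.exp_add]; congr 1; ring
    calc (r - τ) ^ (α - 1) * w τ ≤ (r - τ) ^ (α - 1) * (M * Real.exp (l * τ)) :=
          mul_le_mul_of_nonneg_left h1 h0
      _ = _ := by rw [← h2]; ring
  have hMA : M ≤ 2 * A := by
    have h1 := (hle r hr).trans (add_le_add_right (mul_le_mul_of_nonneg_left hint hB.le) A)
    have h2 : B * (M * Real.exp (l * r) * (ρ ^ α * Real.Gamma α)) = M * Real.exp (l * r) / 2 := by
      rw [show B * (M * Real.exp (l * r) * (ρ ^ α * Real.Gamma α)) =
        M * Real.exp (l * r) * (B * (ρ ^ α * Real.Gamma α)) by ring, hρα]; ring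
    have h3 : M * Real.exp (l * r) = w r := by
      rw [hM, mul_right_comm, ← Real.exp_add, neg_add_cancel, Real.exp_zero, one_mul]
    rw [h2, h3] at h1
    have h4 : w r ≤ 2 * A := by linarith
    have h5 : Real.exp (-(l * r)) ≤ 1 := Real.exp_le_one_iff.2 (by nlinarith [hr.1])
    exact (mul_le_of_le_one_left (hw0 r hr) h5).trans h4
  have hexp : Real.exp (l * t) ≤ Real.exp (l * T) :=
    Real.exp_le_exp.2 (mul_le_mul_of_nonneg_left ht.2 hl0.le)
  calc w t ≤ M * Real.exp (l * t) := hwM t ht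
    _ ≤ 2 * A * Real.exp (l * T) := mul_le_mul hMA hexp (Real.exp_nonneg _) (by positivity)
    _ = 2 * Real.exp (l * T) * A := by ring

/-! ### The energy inequality for functions with a bounded density -/

theorem ae_segMeasure_mem_Ico (T : ℝ) : ∀ᵐ t ∂(segMeasure T), t ∈ Ico 0 T := by
  rw [ae_restrict_iff' measurableSet_Icc]
  have h1 : ∀ᵐ t : ℝ, t ≠ T := by simp [ae_iff, measure_singleton]
  filter_upwards [h1] with t ht htI using ⟨htI.1, lt_of_le_of_ne htI.2 ht⟩

theorem ae_mem_Ioc_of_ae_segMeasure {T t : ℝ} (ht : t ≤ T) {p : ℝ → Prop}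
    (h : ∀ᵐ τ ∂(segMeasure T), p τ) : ∀ᵐ τ : ℝ, τ ∈ Ioc 0 t → p τ := by
  rw [ae_restrict_iff' measurableSet_Icc] at h
  filter_upwards [h] with τ hτ hτt using hτ ⟨hτt.1.le, hτt.2.trans ht⟩

theorem abelIntegral_sub {F : Type*} [NormedAddCommGroup F] [NormedSpace ℝ F] {α : ℝ} (hα : 0 < α)
    {φ ψ : ℝ → F} {C D : ℝ} (hφ : StronglyMeasurable φ) (hC : ∀ τ, ‖φ τ‖ ≤ C)
    (hψ : StronglyMeasurable ψ) (hD : ∀ τ, ‖ψ τ‖ ≤ D) (t : ℝ) :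
    abelIntegral α (fun τ => φ τ - ψ τ) t = abelIntegral α φ t - abelIntegral α ψ t := by
  simp only [abelIntegral, smul_sub]
  exact intervalIntegral.integral_sub (intervalIntegrable_sub_rpow_smul hα hφ hC 0 t t)
    (intervalIntegrable_sub_rpow_smul hα hψ hD 0 t t)

theorem IsBoundedDensity.sub {k : ℕ} {α T C D : ℝ} (hα : 0 < α) {x₀ y₀ : E k}
    {x y φ ψ : ℝ → E k} (hx : IsBoundedDensity α T x₀ x φ C)
    (hy : IsBoundedDensity α T y₀ y ψ D) :
    IsBoundedDensity α T (x₀ - y₀) (fun t => x t - y t) (fun t => φ t - ψ t) (C + D) where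
  stronglyMeasurable := hx.stronglyMeasurable.sub hy.stronglyMeasurable
  norm_le τ := (norm_sub_le _ _).trans (add_le_add (hx.norm_le τ) (hy.norm_le τ))
  eq_add t ht := by
    rw [abelIntegral_sub hα hx.stronglyMeasurable hx.norm_le hy.stronglyMeasurable hy.norm_le,
      hx.eq_add t ht, hy.eq_add t ht, smul_sub]
    abel

theorem intervalIntegrable_sub_rpow_mul_inner {k : ℕ} {α : ℝ} (hα : 0 < α) {ψ s : ℝ → E k}
    {C T t : ℝ} (hψ : StronglyMeasurable ψ) (hC : ∀ τ, ‖ψ τ‖ ≤ C) (hs : ContinuousOn s (Icc 0 T))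
    (ht : t ∈ Icc 0 T) :
    IntervalIntegrable (fun τ => (t - τ) ^ (α - 1) * inner ℝ (ψ τ) (s τ)) volume 0 t := by
  have hC0 : 0 ≤ C := (norm_nonneg _).trans (hC 0)
  obtain ⟨D, hD⟩ := isCompact_Icc.exists_bound_of_continuousOn hs
  have hk := intervalIntegrable_sub_rpow hα 0 t t
  rw [intervalIntegrable_iff_integrableOn_Ioc_of_le ht.1] at hk ⊢
  have hsub : Ioc 0 t ⊆ Icc 0 T := fun τ hτ => ⟨hτ.1.le, hτ.2.trans ht.2⟩
  refine Integrable.mul_bdd (c := C * D) hk (hψ.aestronglyMeasurable.inner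
    ((hs.aestronglyMeasurable measurableSet_Icc).mono_measure (Measure.restrict_mono hsub le_rfl)))
    ?_
  filter_upwards [ae_restrict_mem measurableSet_Ioc] with τ hτ
  exact (norm_inner_le_norm _ _).trans
    (mul_le_mul (hC τ) (hD τ (hsub hτ)) (norm_nonneg _) hC0)

/-- The energy inequality `‖s‖² ≤ ‖s₀‖² + 2 I^α⟨ᶜD^α s, s⟩`. -/
theorem IsBoundedDensity.norm_sq_le {k : ℕ} {α T C : ℝ} (hα₀ : 0 < α) (hα₁ : α < 1)
    {s₀ : E k} {s ψ : ℝ → E k} (h : IsBoundedDensity α T s₀ s ψ C) {t : ℝ} (ht : t ∈ Icc 0 T) :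
    ‖s t‖ ^ 2 ≤ ‖s₀‖ ^ 2 +
      2 / Real.Gamma α * ∫ τ in (0 : ℝ)..t, (t - τ) ^ (α - 1) * inner ℝ (ψ τ) (s τ) := by
  have hΓ := Real.Gamma_pos_of_pos hα₀
  have hca : ContinuousOn (abelIntegral α ψ) (Icc 0 T) :=
    (continuousOn_abelIntegral hα₀ hα₁ h.stronglyMeasurable h.norm_le).mono fun _ ht => ht.1
  have i1 : IntervalIntegrable (fun τ => (t - τ) ^ (α - 1) * inner ℝ (ψ τ) s₀) volume 0 t :=
    intervalIntegrable_sub_rpow_mul_inner hα₀ h.stronglyMeasurable h.norm_le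
      (continuousOn_const (s := Icc 0 T)) ht
  have i2 : IntervalIntegrable
      (fun τ => (t - τ) ^ (α - 1) * inner ℝ (ψ τ) (abelIntegral α ψ τ)) volume 0 t :=
    intervalIntegrable_sub_rpow_mul_inner hα₀ h.stronglyMeasurable h.norm_le hca ht
  -- The part of `⟨ψ, s⟩` coming from the constant `s₀` reproduces exactly the cross term in the
  -- expansion of `‖s t‖²`; an inequality is needed only for the quadratic term.
  have e1 : ∫ τ in (0 : ℝ)..t, (t - τ) ^ (α - 1) * inner ℝ (ψ τ) s₀ =
      inner ℝ s₀ (abelIntegral α ψ t) := by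
    have hi := intervalIntegrable_sub_rpow_smul hα₀ h.stronglyMeasurable h.norm_le 0 t t
    rw [intervalIntegrable_iff_integrableOn_Ioc_of_le ht.1] at hi
    rw [abelIntegral, intervalIntegral.integral_of_le ht.1, intervalIntegral.integral_of_le ht.1,
      ← integral_inner hi]
    refine integral_congr_ae (Filter.Eventually.of_forall fun τ => ?_)
    simp only [real_inner_smul_right, real_inner_comm s₀]
  have e2 : ∫ τ in (0 : ℝ)..t, (t - τ) ^ (α - 1) * inner ℝ (ψ τ) (s τ) =
      inner ℝ s₀ (abelIntegral α ψ t) + 1 / Real.Gamma α *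
        ∫ τ in (0 : ℝ)..t, (t - τ) ^ (α - 1) * inner ℝ (ψ τ) (abelIntegral α ψ τ) := by
    rw [← e1, ← intervalIntegral.integral_const_mul,
      ← intervalIntegral.integral_add i1 (i2.const_mul _)]
    refine intervalIntegral.integral_congr fun τ hτ => ?_
    rw [uIcc_of_le ht.1] at hτ
    rw [h.eq_add τ ⟨hτ.1, hτ.2.trans ht.2⟩, inner_add_right, real_inner_smul_right]
    ring
  have e3 := norm_abelIntegral_sq_le hα₀ hα₁ h.stronglyMeasurable h.norm_le ht.1
  rw [e2, h.eq_add t ht, norm_add_sq_real, real_inner_smul_right, norm_smul, mul_pow,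
    Real.norm_of_nonneg (by positivity)]
  have e4 := mul_le_mul_of_nonneg_left e3 (sq_nonneg (1 / Real.Gamma α))
  refine le_trans (add_le_add_right e4 _) (le_of_eq ?_)
  ring

/-! ### Uniform bounds and mutual aiming for the conflict-controlled system -/

section System

variable {n nu nv : ℕ} {α T : ℝ} {P : Set (E nu)} {Q : Set (E nv)}
  {g : ℝ → E n → E nu → E nv → E n}

/-- Motions that start in a ball are uniformly bounded, with uniformly bounded densities. -/
theorem IsConflictSystem.exists_uniform_bound (hg : IsConflictSystem T P Q g) (hα₀ : 0 < α)
    (hα₁ : α < 1) {R : ℝ} (hR : 0 ≤ R) :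
    ∃ M : ℝ, 0 < M ∧ ∃ G : ℝ, 0 < G ∧ ∀ x₀ ∈ Metric.closedBall (0 : E n) R,
      ∀ u v, IsAdmissible T P u → IsAdmissible T Q v → ∀ x, IsMotion α T g x₀ u v x →
        (∀ t ∈ Icc 0 T, ‖x t‖ ≤ M) ∧ ∃ φ, IsBoundedDensity α T x₀ x φ G ∧
          ∀ᵐ t ∂(segMeasure T), φ t = g t (x t) (u t) (v t) := by
  obtain ⟨c, hc, hgc⟩ := hg.linear_growth
  have hΓ := Real.Gamma_pos_of_pos hα₀
  obtain ⟨K, hK, hgr⟩ := exists_fractional_gronwall hα₀ T (B := 1 / Real.Gamma α * c)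
    (by positivity)
  refine ⟨K * (1 + R), by positivity, K * (1 + R) * c, by positivity, ?_⟩
  intro x₀ hx₀ u v hu hv x hx
  obtain ⟨φ, C, hφ, hφg⟩ := IsCauchySolution.exists_isBoundedDensity hα₀ hα₁ hx
  have hxc := hφ.continuousOn hα₀ hα₁
  have hφle : ∀ᵐ t ∂(segMeasure T), ‖φ t‖ ≤ (1 + ‖x t‖) * c := by
    filter_upwards [hφg, ae_segMeasure_mem_Ico T] with t ht htI
    rw [ht]
    exact hgc t ⟨htI.1, htI.2.le⟩ _ _ (hu.2 t htI) _ (hv.2 t htI)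
  have hw : ContinuousOn (fun t => 1 + ‖x t‖) (Icc 0 T) := continuousOn_const.add hxc.norm
  -- Grönwall is applied to `1 + ‖x‖`, which makes the growth condition homogeneous.
  have hbound : ∀ t ∈ Icc 0 T, 1 + ‖x t‖ ≤ K * (1 + R) := by
    refine hgr (1 + R) _ (by positivity) hw (fun t _ => by positivity) fun t ht => ?_
    have h1 : ‖abelIntegral α φ t‖ ≤
        ∫ τ in (0 : ℝ)..t, c * ((t - τ) ^ (α - 1) * (1 + ‖x τ‖)) := by
      refine intervalIntegral.norm_integral_le_of_norm_le ht.1 ?_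
        ((intervalIntegrable_sub_rpow_mul_of_continuousOn hα₀ hw ht t).const_mul c)
      filter_upwards [ae_mem_Ioc_of_ae_segMeasure ht.2 hφle] with τ hτ hτt
      have h0 : 0 ≤ (t - τ) ^ (α - 1) := Real.rpow_nonneg (by linarith [hτt.2]) _
      rw [norm_smul, Real.norm_of_nonneg h0]
      calc _ ≤ (t - τ) ^ (α - 1) * ((1 + ‖x τ‖) * c) := mul_le_mul_of_nonneg_left (hτ hτt) h0
        _ = _ := by ring
    rw [intervalIntegral.integral_const_mul] at h1
    have h2 : ‖x t‖ ≤ R + 1 / Real.Gamma α * ‖abelIntegral α φ t‖ := by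
      rw [hφ.eq_add t ht]
      refine (norm_add_le _ _).trans (add_le_add (by simpa using hx₀) ?_)
      rw [norm_smul, Real.norm_of_nonneg (by positivity)]
    have h3 := mul_le_mul_of_nonneg_left h1 (show 0 ≤ 1 / Real.Gamma α by positivity)
    linarith
  refine ⟨fun t ht => by linarith [hbound t ht], ?_⟩
  obtain ⟨φ', hφ', hae⟩ := hφ.exists_norm_le (C' := K * (1 + R) * c) (by positivity) (by
    filter_upwards [hφle, ae_restrict_mem measurableSet_Icc] with t ht htI
    exact ht.trans (mul_le_mul_of_nonneg_right (hbound t htI) hc.le))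
  refine ⟨φ', hφ', ?_⟩
  filter_upwards [hφg, hae] with t h1 h2
  rw [← h2, h1]

/-- Extremal controls at a position realize the saddle point of the small game. -/
theorem IsConflictSystem.inner_le_inner_of_mem_argMin_argMax (hg : IsConflictSystem T P Q g)
    {t : ℝ} (ht : t ∈ Icc 0 T) (x s : E n) {u u' : E nu} {v v' : E nv}
    (hu : u ∈ argMin P (maxOverQ Q g t x s)) (hv' : v' ∈ argMax Q (minOverP P g t x s))
    (hu' : u' ∈ P) (hv : v ∈ Q) : inner ℝ s (g t x u v) ≤ inner ℝ s (g t x u' v') := by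
  obtain ⟨c, hc, hgc⟩ := hg.linear_growth
  have hb : ∀ u ∈ P, ∀ v ∈ Q, |inner ℝ s (g t x u v)| ≤ ‖s‖ * ((1 + ‖x‖) * c) :=
    fun u hu v hv => (abs_real_inner_le_norm _ _).trans
      (mul_le_mul_of_nonneg_left (hgc t ht x u hu v hv) (norm_nonneg _))
  have : Nonempty P := ⟨⟨u', hu'⟩⟩
  have : Nonempty Q := ⟨⟨v, hv⟩⟩
  have hsup : BddAbove (range fun w : Q => (inner ℝ s (g t x u w) : ℝ)) :=
    ⟨_, by rintro _ ⟨w, rfl⟩; exact (abs_le.1 (hb u hu.1 w w.2)).2⟩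
  have hinf : BddBelow (range fun w : P => (inner ℝ s (g t x w v') : ℝ)) :=
    ⟨_, by rintro _ ⟨w, rfl⟩; exact (abs_le.1 (hb w w.2 v' hv'.1)).1⟩
  calc inner ℝ s (g t x u v) ≤ maxOverQ Q g t x s u := le_ciSup hsup ⟨v, hv⟩
    _ ≤ ⨅ w : P, maxOverQ Q g t x s w := le_ciInf fun w => hu.2 w.2
    _ = ⨆ w : Q, minOverP P g t x s w := hg.saddle_point t ht x s
    _ ≤ minOverP P g t x s v' := ciSup_le fun w => hv'.2 w.2
    _ ≤ inner ℝ s (g t x u' v') := ciInf_le hinf ⟨u', hu'⟩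

/-- Uniform continuity of `g` on a compact set; the modulus serves all controls at once. -/
theorem IsConflictSystem.exists_modulus (hg : IsConflictSystem T P Q g) (M : ℝ) {η : ℝ}
    (hη : 0 < η) :
    ∃ δ : ℝ, 0 < δ ∧ ∀ t ∈ Icc 0 T, ∀ r ∈ Icc 0 T, |t - r| ≤ δ → ∀ x y : E n, ‖x‖ ≤ M → ‖y‖ ≤ M →
      ‖x - y‖ ≤ δ → ∀ u ∈ P, ∀ v ∈ Q, ‖g t x u v - g r y u v‖ ≤ η := by
  have hcomp : IsCompact (Icc 0 T ×ˢ Metric.closedBall (0 : E n) M ×ˢ P ×ˢ Q) :=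
    isCompact_Icc.prod ((isCompact_closedBall _ _).prod (hg.compact_P.prod hg.compact_Q))
  have huc := hcomp.uniformContinuousOn_of_continuous (hg.continuousOn.mono
    (prod_mono le_rfl (prod_mono (subset_univ _) le_rfl)))
  rw [Metric.uniformContinuousOn_iff] at huc
  obtain ⟨δ, hδ, h⟩ := huc η hη
  refine ⟨δ / 2, by positivity, fun t ht r hr htr x y hx hy hxy u hu v hv => ?_⟩
  have := h (t, x, u, v) ⟨ht, by simpa using hx, hu, hv⟩ (r, y, u, v)
    ⟨hr, by simpa using hy, hu, hv⟩ (by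
      refine max_lt ?_ (max_lt ?_ (max_lt ?_ ?_))
      · exact htr.trans_lt (half_lt_self hδ)
      · exact (dist_eq_norm x y).trans_lt (hxy.trans_lt (half_lt_self hδ))
      · exact (dist_self u).trans_lt hδ
      · exact (dist_self v).trans_lt hδ)
  rw [dist_eq_norm] at this
  exact this.le

theorem TimePartition.node_mem_Icc (Δ : TimePartition T) (i : Fin (Δ.k + 1)) :
    Δ.node i ∈ Icc 0 T :=
  ⟨Δ.node_zero ▸ Δ.strictMono.monotone (Fin.zero_le i),
    (Δ.strictMono.monotone (Fin.le_last i)).trans_eq Δ.node_last⟩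

/-- Descend from the last node, which exceeds `t`, until a node not exceeding `t` is met; the node
at 0 guarantees a stop. -/
theorem TimePartition.exists_mem_Ico (Δ : TimePartition T) {t : ℝ} (ht : t ∈ Ico 0 T) :
    ∃ j : Fin Δ.k, t ∈ Ico (Δ.node j.castSucc) (Δ.node j.succ) := by
  have key : ∀ i : Fin (Δ.k + 1), t < Δ.node i →
      ∃ j : Fin Δ.k, t ∈ Ico (Δ.node j.castSucc) (Δ.node j.succ) := by
    intro i
    induction i using Fin.induction with
    | zero => intro h; rw [Δ.node_zero] at h; exact absurd ht.1 (not_le.2 h)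
    | succ j ih =>
      intro h
      by_cases h' : t < Δ.node j.castSucc
      · exact ih h'
      · exact ⟨j, not_lt.1 h', h⟩
  exact key (Fin.last _) (by rw [Δ.node_last]; exact ht.2)

theorem TimePartition.node_sub_le_diam (Δ : TimePartition T) (j : Fin Δ.k) :
    Δ.node j.succ - Δ.node j.castSucc ≤ Δ.diam :=
  le_ciSup (f := fun j : Fin Δ.k => Δ.node j.succ - Δ.node j.castSucc)
    (finite_range _).bddAbove j

theorem exists_forall_mul_rpow_le (hα : 0 < α) {H e : ℝ} (hH : 0 ≤ H) (he : 0 < e) :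
    ∃ δ : ℝ, 0 < δ ∧ ∀ r, 0 ≤ r → r ≤ δ → H * r ^ α ≤ e := by
  -- `H + 1` in place of `H` covers the case `H = 0`.
  refine ⟨(e / (H + 1)) ^ (1 / α), Real.rpow_pos_of_pos (by positivity) _, fun r hr hrδ => ?_⟩
  have h1 : r ^ α ≤ e / (H + 1) := by
    refine (Real.rpow_le_rpow hr hrδ hα.le).trans_eq ?_
    rw [← Real.rpow_mul (by positivity), one_div_mul_cancel hα.ne', Real.rpow_one]
  calc H * r ^ α ≤ (H + 1) * (e / (H + 1)) := by
        refine mul_le_mul (by linarith) h1 (Real.rpow_nonneg hr _) (by positivity)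
    _ = e := by field_simp

/-- On a fine partition, mutual aiming makes the distance between the motions grow at most
exponentially, up to a small error. -/
theorem IsConflictSystem.exists_inner_le (hg : IsConflictSystem T P Q g) (hα₀ : 0 < α)
    (hα₁ : α < 1) {M G : ℝ} (hM : 0 < M) (hG : 0 < G) :
    ∃ L : ℝ, 0 < L ∧ ∀ η : ℝ, 0 < η → ∃ δ : ℝ, 0 < δ ∧
      ∀ (Δ : TimePartition T), Δ.diam ≤ δ → ∀ (x₀ y₀ : E n) (x y φ ψ : ℝ → E n) (u u' : ℝ → E nu)
        (v v' : ℝ → E nv), IsBoundedDensity α T x₀ x φ G → IsBoundedDensity α T y₀ y ψ G →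
        (∀ t ∈ Icc 0 T, ‖x t‖ ≤ M) → (∀ t ∈ Icc 0 T, ‖y t‖ ≤ M) →
        IsAdmissible T P u' → IsAdmissible T Q v → IsMutualAiming P Q g Δ x y u v' →
        ∀ t ∈ Ico 0 T, inner ℝ (g t (x t) (u t) (v t) - g t (y t) (u' t) (v' t)) (x t - y t) ≤
          L * ‖x t - y t‖ ^ 2 + η := by
  obtain ⟨c, hc, hgc⟩ := hg.linear_growth
  obtain ⟨L, hL, hlip⟩ := hg.locally_lipschitz M hM.le
  have hΓ := Real.Gamma_pos_of_pos hα₀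
  refine ⟨L, hL, fun η hη => ?_⟩
  set G' : ℝ := (1 + M) * c with hG'
  have hG'0 : 0 < G' := by positivity
  -- The error `η` is shared out: `‖sr‖ ≤ 2M` turns `η/(8M)` into `η/4` in each of `t3` and `t4`.
  -- The bound `η/(8G')` on the increments of `x` and of `y` yields `‖s - sr‖ ≤ η/(4G')`, hence
  -- `η/2` in `t2`.
  obtain ⟨δ₁, hδ₁, hmod⟩ := hg.exists_modulus M (η := η / (8 * M)) (by positivity)
  obtain ⟨δ₂, hδ₂, hH⟩ := exists_forall_mul_rpow_le hα₀
    (H := 1 / Real.Gamma α * (2 * G / α)) (e := min δ₁ (η / (8 * G'))) (by positivity)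
    (by positivity)
  refine ⟨min δ₁ δ₂, by positivity, ?_⟩
  intro Δ hΔ x₀ y₀ x y φ ψ u u' v v' hx hy hxM hyM hu' hv haim t ht
  obtain ⟨j, hj⟩ := Δ.exists_mem_Ico ht
  obtain ⟨⟨uj, huj, huu⟩, ⟨vj, hvj, hvv⟩⟩ := haim j
  set r : ℝ := Δ.node j.castSucc with hr
  have hrI : r ∈ Icc 0 T := Δ.node_mem_Icc _
  have htI : t ∈ Icc 0 T := ⟨ht.1, ht.2.le⟩
  have htr : t - r ≤ min δ₁ δ₂ := by
    have h := Δ.node_sub_le_diam j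
    have h2 := hj.2
    linarith
  have htr0 : 0 ≤ t - r := sub_nonneg.2 hj.1
  have hsmall := hH (t - r) htr0 (htr.trans (min_le_right _ _))
  have hxr := (hx.norm_increment_le hα₀ hα₁ hrI.1 hj.1 htI.2).trans hsmall
  have hyr := (hy.norm_increment_le hα₀ hα₁ hrI.1 hj.1 htI.2).trans hsmall
  rw [huu t hj, hvv t hj]
  have hPu' := hu'.2 t ht
  have hQv := hv.2 t ht
  have hmod' := fun a ha b hb => hmod t htI r hrI
    (by rw [abs_of_nonneg htr0]; exact htr.trans (min_le_left _ _)) (x t) (x r) (hxM t htI)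
    (hxM r hrI) (hxr.trans (min_le_left _ _)) a ha b hb
  have hgb : ∀ a ∈ P, ∀ b ∈ Q, ‖g t (x t) a b‖ ≤ G' := fun a ha b hb =>
    (hgc t htI (x t) a ha b hb).trans
      (mul_le_mul_of_nonneg_right (by linarith [hxM t htI]) hc.le)
  set s := x t - y t with hs
  set sr := x r - y r with hsr
  have hsr_le : ‖sr‖ ≤ 2 * M := (norm_sub_le _ _).trans (by linarith [hxM r hrI, hyM r hrI])
  have hssr : ‖s - sr‖ ≤ η / (4 * G') := by
    have e : s - sr = (x t - x r) - (y t - y r) := by rw [hs, hsr]; abel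
    rw [e]
    refine (norm_sub_le _ _).trans ((add_le_add (hxr.trans (min_le_right _ _))
      (hyr.trans (min_le_right _ _))).trans (le_of_eq ?_))
    field_simp
    norm_num
  -- `y` is first replaced by `x` under the same controls `(u', vj)`, at Lipschitz cost `t1`. The
  -- remaining difference of control pairs at `x` is moved from `s` to `sr` (`t2`) and from time `t`
  -- to `r` (`t3`, `t4`), where the saddle point gives it a sign (`t5`).
  have t1 : inner ℝ s (g t (x t) (u' t) vj - g t (y t) (u' t) vj) ≤ L * ‖s‖ ^ 2 := by
    refine (real_inner_le_norm _ _).trans ?_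
    have := hlip t htI (x t) (by simpa using hxM t htI) (y t) (by simpa using hyM t htI)
      (u' t) hPu' vj hvj.1
    calc _ ≤ ‖s‖ * (L * ‖s‖) := mul_le_mul_of_nonneg_left this (norm_nonneg _)
      _ = _ := by ring
  have t2 : inner ℝ (s - sr) (g t (x t) uj (v t) - g t (x t) (u' t) vj) ≤ η / 2 := by
    refine (real_inner_le_norm _ _).trans ?_
    have h2 : ‖g t (x t) uj (v t) - g t (x t) (u' t) vj‖ ≤ 2 * G' :=
      (norm_sub_le _ _).trans (by linarith [hgb uj huj.1 (v t) hQv, hgb (u' t) hPu' vj hvj.1])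
    refine (mul_le_mul hssr h2 (norm_nonneg _) (by positivity)).trans (le_of_eq ?_)
    field_simp
    norm_num
  have hbd : ∀ z : E n, ‖z‖ ≤ η / (8 * M) → inner ℝ sr z ≤ η / 4 := fun z hz => by
    refine (real_inner_le_norm _ _).trans ((mul_le_mul hsr_le hz (norm_nonneg _)
      (by positivity)).trans (le_of_eq ?_))
    field_simp
    norm_num
  have t3 := hbd _ (hmod' uj huj.1 (v t) hQv)
  have t4 := hbd (g r (x r) (u' t) vj - g t (x t) (u' t) vj)
    (by rw [norm_sub_rev]; exact hmod' (u' t) hPu' vj hvj.1)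
  have t5 := hg.inner_le_inner_of_mem_argMin_argMax hrI (x r) sr huj hvj hPu' hQv
  rw [real_inner_comm]
  simp only [inner_sub_right, inner_sub_left] at t1 t2 t3 t4 t5 ⊢
  linarith

end System

end FractionalControl

/-! ### The stability estimate -/

theorem mainTheorem1 (n nu nv : ℕ) (α T : ℝ) (hα₀ : 0 < α) (hα₁ : α < 1) (hT : 0 < T)
    (P : Set (FractionalControl.E nu)) (Q : Set (FractionalControl.E nv))
    (g : ℝ → FractionalControl.E n → FractionalControl.E nu → FractionalControl.E nv →
      FractionalControl.E n)
    (hg : FractionalControl.IsConflictSystem T P Q g) :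
    ∀ R₀ : ℝ, 0 < R₀ → ∀ ε : ℝ, 0 < ε →
      ∃ K : ℝ, 0 < K ∧ ∃ δ : ℝ, 0 < δ ∧
        ∀ x₀ ∈ Metric.closedBall (0 : FractionalControl.E n) R₀,
        ∀ y₀ ∈ Metric.closedBall (0 : FractionalControl.E n) R₀,
        ∀ Δ : FractionalControl.TimePartition T, Δ.diam ≤ δ →
        ∀ v : ℝ → FractionalControl.E nv, FractionalControl.IsAdmissible T Q v →
        ∀ u' : ℝ → FractionalControl.E nu, FractionalControl.IsAdmissible T P u' →
        ∀ u : ℝ → FractionalControl.E nu, FractionalControl.IsAdmissible T P u →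
        ∀ v' : ℝ → FractionalControl.E nv, FractionalControl.IsAdmissible T Q v' →
        ∀ x y : ℝ → FractionalControl.E n,
          FractionalControl.IsMotion α T g x₀ u v x →
          FractionalControl.IsMotion α T g y₀ u' v' y →
          FractionalControl.IsMutualAiming P Q g Δ x y u v' →
            MeasureTheory.eLpNorm (fun t => x t - y t) ⊤ (FractionalControl.segMeasure T) ≤
              ENNReal.ofReal (ε + K * ‖x₀ - y₀‖) := by
  open FractionalControl in
  intro R₀ hR₀ ε hε
  have hΓ := Real.Gamma_pos_of_pos hα₀
  obtain ⟨M, hM, G, hG, hbd⟩ := hg.exists_uniform_bound hα₀ hα₁ hR₀.le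
  obtain ⟨L, hL, hinner⟩ := hg.exists_inner_le hα₀ hα₁ hM hG
  obtain ⟨K, hK, hgr⟩ := exists_fractional_gronwall hα₀ T (B := 2 / Real.Gamma α * L)
    (by positivity)
  have hTα : 0 < T ^ α := Real.rpow_pos_of_pos hT α
  -- `D` is the factor by which the final estimate multiplies `η`, so `η = ε²/D` contributes exactly
  -- `ε²`. This is not circular: `L`, and hence `K`, was fixed before `η`.
  set D : ℝ := K * (2 / Real.Gamma α * (T ^ α / α)) with hD
  have hD0 : 0 < D := by positivity
  obtain ⟨δ, hδ, haim⟩ := hinner (ε ^ 2 / D) (by positivity)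
  -- Grönwall bounds the squared distance by `K‖x₀ - y₀‖² + ε²`; the square root is taken at the
  -- end, using the nonnegative cross term.
  refine ⟨√K, Real.sqrt_pos.2 hK, δ, hδ, ?_⟩
  intro x₀ hx₀ y₀ hy₀ Δ hΔ v hv u' hu' u hu v' hv' x y hx hy hmut
  obtain ⟨hxM, φ, hφ, hφg⟩ := hbd x₀ hx₀ u v hu hv x hx
  obtain ⟨hyM, ψ, hψ, hψg⟩ := hbd y₀ hy₀ u' v' hu' hv' y hy
  have hs := hφ.sub hα₀ hψ
  have hsc := hs.continuousOn hα₀ hα₁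
  have hpt := haim Δ hΔ x₀ y₀ x y φ ψ u u' v v' hφ hψ hxM hyM hu' hv hmut
  set A : ℝ := ‖x₀ - y₀‖ ^ 2 + 2 / Real.Gamma α * (ε ^ 2 / D * (T ^ α / α)) with hA
  have hw : ContinuousOn (fun t => ‖x t - y t‖ ^ 2) (Icc 0 T) := hsc.norm.pow 2
  have hfin : ∀ t ∈ Icc 0 T, ‖x t - y t‖ ^ 2 ≤ K * A := by
    refine hgr A _ (by positivity) hw (fun t _ => by positivity) fun t ht => ?_
    refine (hs.norm_sq_le hα₀ hα₁ ht).trans ?_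
    have i1 := intervalIntegrable_sub_rpow_mul_inner hα₀ hs.stronglyMeasurable hs.norm_le hsc ht
    have i2 := intervalIntegrable_sub_rpow_mul_of_continuousOn hα₀ hw ht t
    have i3 := intervalIntegrable_sub_rpow hα₀ 0 t t
    have h1 : ∫ τ in (0 : ℝ)..t, (t - τ) ^ (α - 1) * inner ℝ (φ τ - ψ τ) (x τ - y τ) ≤
        ∫ τ in (0 : ℝ)..t, (L * ((t - τ) ^ (α - 1) * ‖x τ - y τ‖ ^ 2) +
          ε ^ 2 / D * (t - τ) ^ (α - 1)) := by
      refine intervalIntegral.integral_mono_ae_restrict ht.1 i1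
        ((i2.const_mul L).add (i3.const_mul _)) ?_
      have hae : ∀ᵐ τ ∂(volume.restrict (Icc 0 t)), τ ∈ Icc 0 t := ae_restrict_mem measurableSet_Icc
      have hmono : ∀ {p : ℝ → Prop}, (∀ᵐ τ ∂(segMeasure T), p τ) →
          ∀ᵐ τ ∂(volume.restrict (Icc 0 t)), p τ := fun h =>
        ae_mono (Measure.restrict_mono (Icc_subset_Icc_right ht.2) le_rfl) h
      -- The point `T` is removed because the controls are constrained only on `[0, T)`.
      filter_upwards [hae, hmono hφg, hmono hψg, hmono (ae_segMeasure_mem_Ico T)] with τ h0 h1 h2 h3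
      have hk : 0 ≤ (t - τ) ^ (α - 1) := Real.rpow_nonneg (by linarith [h0.2]) _
      rw [h1, h2]
      refine (mul_le_mul_of_nonneg_left (hpt τ h3) hk).trans (le_of_eq ?_)
      ring
    rw [intervalIntegral.integral_add (i2.const_mul L) (i3.const_mul _),
      intervalIntegral.integral_const_mul, intervalIntegral.integral_const_mul,
      integral_sub_rpow hα₀, sub_self, sub_zero, Real.zero_rpow hα₀.ne', sub_zero] at h1
    have h2 : t ^ α / α ≤ T ^ α / α :=
      div_le_div_of_nonneg_right (Real.rpow_le_rpow ht.1 ht.2 hα₀.le) hα₀.le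
    have h3 := mul_le_mul_of_nonneg_left h2 (show 0 ≤ ε ^ 2 / D by positivity)
    have h4 := mul_le_mul_of_nonneg_left (h1.trans (add_le_add_right h3 _))
      (show 0 ≤ 2 / Real.Gamma α by positivity)
    rw [hA]
    linarith
  rw [eLpNorm_exponent_top]
  refine eLpNormEssSup_le_of_ae_bound ?_
  filter_upwards [ae_restrict_mem measurableSet_Icc] with t ht
  refine abs_le_of_sq_le_sq' ?_ (by positivity) |>.2
  have hKA : K * A = K * ‖x₀ - y₀‖ ^ 2 + ε ^ 2 := by
    rw [hA, mul_add]
    congr 1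
    rw [hD]
    field_simp
  have hsq : √K ^ 2 = K := Real.sq_sqrt hK.le
  have hcross : 0 ≤ 2 * ε * (√K * ‖x₀ - y₀‖) := by positivity
  calc ‖x t - y t‖ ^ 2 ≤ K * ‖x₀ - y₀‖ ^ 2 + ε ^ 2 := hKA ▸ hfin t ht
    _ = √K ^ 2 * ‖x₀ - y₀‖ ^ 2 + ε ^ 2 := by rw [hsq]
    _ ≤ (ε + √K * ‖x₀ - y₀‖) ^ 2 := by linarith
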